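/- Let $d,K\in\mathbb{N}$, let $f_1,\dots,f_K:\mathbb{R}^d\to\mathbb{R}$ be differentiable, and let $k_1,k_2,\dots$ be independent random variables, each uniformly distributed on $\{1,\dots,K\}$. For $\sigma\ge 0$ and $g:\mathbb{R}^d\to\mathbb{R}$ let $$g_\sigma(x)=\frac{1}{\pi^{d/2}}\int_{\mathbb{R}^d}g(x+\sigma u)\,e^{-\|u\|^2}\,du ,$$ and write $f_{k,\sigma}=(f_k)_\sigma$. Let $\eta_t>0$, $\epsilon>0$, $0\le\beta_t\le\beta<1$, $\theta_t\in(0,1)$, $\sigma_t\ge 0$ ($t\ge1$) and $x_0\in\mathbb{R}^d$. GSmoothAdam starts from $m_0=0$, $v_0=0$ and $x_0$ and iterates, for $t=1,2,\dots$, $$g_t=\nabla f_{k_t,\sigma_t}(x_{t-1}),\quad m_t=\beta_t m_{t-1}+(1-\beta_t)g_t,\quad v_t=\theta_t v_{t-1}+(1-\theta_t)g_t^2,\quad x_t=x_{t-1}-\eta_t\frac{m_t}{\sqrt{v_t+\epsilon}},$$ where squares, square roots and quotients of vectors are taken coordinate-wise. Let $f:\mathbb{R}^d\to\mathbb{R}$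 be bounded below (in particular, this holds if $f$ attains a minimum $f^*$) and $L$-smooth, i.e. $|f(y)-f(x)-\langle\nabla f(x),y-x\rangle|\le\frac L2\|y-x\|^2$ for all $x,y\in\mathbb{R}^d$. Write $E_k(a_k)=\frac1K\sum_{k=1}^K a_k$, and assume that $E_k(f_k(x))=f(x)$ and $E_k(\nabla f_k(x))=\nabla f(x)$ for almost every $x\in\mathbb{R}^d$, and that for some constant $\lambda$ we have $E_k(\|\nabla f_k(x)\|^2)\le\lambda$ for all $x\in\mathbb{R}^d$. Suppose further that $$\sum_{t=1}^\infty\eta_t=\infty,\qquad \sum_{t=1}^\infty\eta_t^2<\infty,\qquad \sum_{t=1}^\infty\eta_t(1-\theta_t)<\infty,$$ and that there are a non-increasing real sequence $(\alpha_t)_{t\ge1}$ and constants $C_0,\widetilde C_0>0$ with $C_0\alpha_t\le\eta_t\le\widetilde C_0\alpha_t$ for all $t\ge 1$ (that is, $\eta_t=\Theta(\alpha_t)$). If $\sqrt{|\sigma_t^2-\sigma_{t+1}^2|}\le\eta_t$ for all $t\ge1$ and $\sigma_t\to0$, then $$\lim_{t\to\infty}\|\nabla f(x_t)\|^2=0\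 \text{ almost surely}\qquad\text{and}\qquad \lim_{t\to\infty}E\big(\|\nabla f(x_t)\|^2\big)=0,$$ where all the expectations $E(\|\nabla f(x_t)\|^2)$ are finite. -/

import Mathlib

open MeasureTheory ProbabilityTheory Filter Topology

noncomputable section

/-- The `σ`-Gaussian smoothing of `g : ℝ^d → ℝ`,
`g_σ(x) = π^{-d/2} ∫ g(x + σ u) exp(-‖u‖²) du`; for `σ = 0` this is `g` itself. -/
def gaussianSmooth {d : ℕ} (σ : ℝ) (g : EuclideanSpace ℝ (Fin d) → ℝ)
    (x : EuclideanSpace ℝ (Fin d)) : ℝ :=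
  1 / Real.pi ^ ((d : ℝ) / 2) *
    ∫ u : EuclideanSpace ℝ (Fin d), g (x + σ • u) * Real.exp (-‖u‖ ^ 2)

/-- `f` is `L`-smooth: `|f(y) - f(x) - ⟨∇f(x), y - x⟩| ≤ (L/2) ‖y - x‖²` for all `x`, `y`.
The bound forces `f` to be differentiable everywhere, so `gradient f` is never a junk value. -/
def IsLSmooth {d : ℕ} (L : ℝ) (f : EuclideanSpace ℝ (Fin d) → ℝ) : Prop :=
  ∀ x y : EuclideanSpace ℝ (Fin d),
    |f y - f x - inner ℝ (gradient f x) (y - x)| ≤ L / 2 * ‖y - x‖ ^ 2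

/-- The state of the algorithm: momentum `m`, second-moment estimate `v`, iterate `x`. -/
structure AdamState (d : ℕ) where
  m : EuclideanSpace ℝ (Fin d)
  v : EuclideanSpace ℝ (Fin d)
  x : EuclideanSpace ℝ (Fin d)

/-- One step of Adam with stochastic gradient `g` and parameters `η, β, θ, ε`; squares, square
roots and quotients of vectors are coordinate-wise. -/
def adamStep {d : ℕ} (η β θ ε : ℝ) (g : EuclideanSpace ℝ (Fin d)) (s : AdamState d) :
    AdamState d :=
  let m' : EuclideanSpace ℝ (Fin d) := β • s.m + (1 - β) • g
  let v' : EuclideanSpace ℝ (Fin d) :=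
    WithLp.toLp 2 (fun i => θ * s.v i + (1 - θ) * (g i) ^ 2)
  { m := m'
    v := v'
    x := WithLp.toLp 2 (fun i => s.x i - η * (m' i / Real.sqrt (v' i + ε))) }

/-- GSmoothAdam along a sequence `k 1, k 2, …` of sampled indices: the state after `t` steps,
where step `t ≥ 1` uses `η t, β t, θ t, σ t` and the gradient of the `σ t`-smoothing of
`F (k t)` at the previous iterate. The values of the sequences at index `0` are not used. -/
def gsmoothAdam {d K : ℕ} (F : Fin K → EuclideanSpace ℝ (Fin d) → ℝ)
    (η β θ σ : ℕ → ℝ) (ε : ℝ) (x₀ : EuclideanSpace ℝ (Fin d)) (k : ℕ → Fin K) :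
    ℕ → AdamState d
  | 0 => { m := 0, v := 0, x := x₀ }
  | t + 1 =>
    let s := gsmoothAdam F η β θ σ ε x₀ k t
    adamStep (η (t + 1)) (β (t + 1)) (θ (t + 1)) ε
      (gradient (gaussianSmooth (σ (t + 1)) (F (k (t + 1)))) s.x) s

end

noncomputable section

/-! Write φ_t for the smoothing of f at scale σ_t, p_t = ∇φ_{t+1}(x_t), and D_t for the diagonal
matrix with entries 1/√(v_t+ε). The bound on the mean squared gradient makes every F_j Lipschitz
with one constant G, so all sampled gradients, m_t and √v_t stay bounded and D_t lies between two
positive multiples of the identity.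

Passing from σ_t to σ_{t+1} changes ∇φ by O(|σ_t-σ_{t+1}|) = O(η_t), and φ only by
O(|σ_t²-σ_{t+1}²|) = O(η_t²), because the first-order terms at u and -u cancel.

Momentum correlates the step with past samples, so f alone is not a good potential. The slope M_t =
⟨p_{t-1}, D_t m_t⟩ satisfies M_{t+1} ≥ β_{t+1} M_t + (1-β_{t+1})⟨p_t, D_t g_{t+1}⟩ - O(η_t +
1-θ_{t+1}). With weights solving w_t = η_t + β_{t+1} w_{t+1} and comparable to η_t
(`exists_momentum_weights`), the potential φ_{t+1}(x_t) - β_{t+1} w_{t+1} M_t absorbs the momentum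
exactly (`adamLyapunov_succ_le`). Since D_t and p_t are determined by the first t samples, averaging
over the next one replaces g_{t+1} by p_t (`integral_next_sample`, `mean_gradient_gaussianSmooth`).

Telescoping expectations gives ∑ η_{t+1} E‖p_t‖² < ∞, hence ∑ η_{t+1}‖p_t‖² < ∞ almost surely. As
‖p_t‖² moves by O(η_{t+1}) per step and ∑ η_t = ∞, it tends to 0 (`tendsto_zero_of_summable_mul`).
Finally ‖∇f(x_t) - p_t‖ = O(σ_{t+1}) → 0, and dominated convergence gives the limit of the
expectations. -/

/-! ### Gaussian measure and its moments -/

/-- The probability measure on `ℝ^d` with density `π^{-d/2} exp(-‖u‖²)`. -/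
def gaussMeasure (d : ℕ) : Measure (EuclideanSpace ℝ (Fin d)) :=
  volume.withDensity fun u => ENNReal.ofReal (1 / Real.pi ^ ((d : ℝ) / 2) * Real.exp (-‖u‖ ^ 2))

lemma gaussDensity_nonneg {d : ℕ} (u : EuclideanSpace ℝ (Fin d)) :
    0 ≤ 1 / Real.pi ^ ((d : ℝ) / 2) * Real.exp (-‖u‖ ^ 2) := by positivity

lemma measurable_gaussDensity (d : ℕ) : Measurable fun u : EuclideanSpace ℝ (Fin d) =>
    ENNReal.ofReal (1 / Real.pi ^ ((d : ℝ) / 2) * Real.exp (-‖u‖ ^ 2)) := by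
  fun_prop

lemma integrable_exp_neg_mul_norm_sq {d : ℕ} {b : ℝ} (hb : 0 < b) :
    Integrable fun u : EuclideanSpace ℝ (Fin d) => Real.exp (-b * ‖u‖ ^ 2) := by
  -- A non-integrable function has integral 0 by convention, which contradicts the positive value of
  -- the Gaussian integral.
  by_contra h
  have h1 := GaussianFourier.integral_rexp_neg_mul_sq_norm (V := EuclideanSpace ℝ (Fin d)) hb
  rw [integral_undef h] at h1
  have : 0 < (Real.pi / b) ^ ((Module.finrank ℝ (EuclideanSpace ℝ (Fin d)) : ℝ) / 2) := by
    have := Real.pi_pos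
    positivity
  linarith

lemma integral_gaussMeasure {d : ℕ} {V : Type*} [NormedAddCommGroup V] [NormedSpace ℝ V]
    (g : EuclideanSpace ℝ (Fin d) → V) :
    ∫ u, g u ∂gaussMeasure d
      = ∫ u, (1 / Real.pi ^ ((d : ℝ) / 2) * Real.exp (-‖u‖ ^ 2)) • g u := by
  rw [gaussMeasure, integral_withDensity_eq_integral_toReal_smul (measurable_gaussDensity d)
    (by simp)]
  simp_rw [ENNReal.toReal_ofReal (gaussDensity_nonneg _)]

lemma integrable_gaussMeasure_iff {d : ℕ} {V : Type*} [NormedAddCommGroup V] [NormedSpace ℝ V]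
    {g : EuclideanSpace ℝ (Fin d) → V} :
    Integrable g (gaussMeasure d) ↔
      Integrable fun u => (1 / Real.pi ^ ((d : ℝ) / 2) * Real.exp (-‖u‖ ^ 2)) • g u := by
  rw [gaussMeasure, integrable_withDensity_iff_integrable_smul₀'
    (measurable_gaussDensity d).aemeasurable (by simp)]
  simp_rw [ENNReal.toReal_ofReal (gaussDensity_nonneg _)]

instance (d : ℕ) : IsProbabilityMeasure (gaussMeasure d) := by
  constructor
  have h1 := GaussianFourier.integral_rexp_neg_mul_sq_norm (V := EuclideanSpace ℝ (Fin d))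
    one_pos
  have h2 := (integrable_exp_neg_mul_norm_sq (d := d) one_pos).const_mul
    (1 / Real.pi ^ ((d : ℝ) / 2))
  simp only [neg_one_mul, finrank_euclideanSpace, Fintype.card_fin, div_one] at h1 h2
  rw [gaussMeasure, withDensity_apply _ MeasurableSet.univ, Measure.restrict_univ,
    ← ofReal_integral_eq_lintegral_ofReal h2 (ae_of_all _ gaussDensity_nonneg),
    integral_const_mul, h1, one_div_mul_cancel, ENNReal.ofReal_one]
  have := Real.pi_pos
  positivity

lemma integral_neg_gaussMeasure {d : ℕ} (g : EuclideanSpace ℝ (Fin d) → ℝ) :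
    ∫ u, g (-u) ∂gaussMeasure d = ∫ u, g u ∂gaussMeasure d := by
  rw [integral_gaussMeasure, integral_gaussMeasure, ← integral_neg_eq_self]
  simp

lemma integrable_norm_sq_gaussMeasure (d : ℕ) :
    Integrable (fun u : EuclideanSpace ℝ (Fin d) => ‖u‖ ^ 2) (gaussMeasure d) := by
  rw [integrable_gaussMeasure_iff]
  refine ((integrable_exp_neg_mul_norm_sq (d := d) (b := 1 / 2) (by norm_num)).const_mul
    (1 / Real.pi ^ ((d : ℝ) / 2) * 2)).mono' (by fun_prop) (ae_of_all _ fun u => ?_)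
  have h0 : 0 ≤ 1 / Real.pi ^ ((d : ℝ) / 2) := by positivity
  rw [smul_eq_mul, Real.norm_of_nonneg (by positivity), mul_assoc, mul_assoc]
  refine mul_le_mul_of_nonneg_left ?_ h0
  have h1 : ‖u‖ ^ 2 ≤ 2 * Real.exp (1 / 2 * ‖u‖ ^ 2) := by
    have := Real.add_one_le_exp (1 / 2 * ‖u‖ ^ 2)
    linarith
  calc Real.exp (-‖u‖ ^ 2) * ‖u‖ ^ 2
      ≤ Real.exp (-‖u‖ ^ 2) * (2 * Real.exp (1 / 2 * ‖u‖ ^ 2)) := by gcongr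
    _ = 2 * Real.exp (-(1 / 2) * ‖u‖ ^ 2) := by
        rw [mul_left_comm, ← Real.exp_add]
        ring_nf

lemma integrable_norm_gaussMeasure (d : ℕ) :
    Integrable (fun u : EuclideanSpace ℝ (Fin d) => ‖u‖) (gaussMeasure d) := by
  refine ((integrable_norm_sq_gaussMeasure d).add (integrable_const 1)).mono' (by fun_prop)
    (ae_of_all _ fun u => ?_)
  rw [norm_norm, Pi.add_apply]
  nlinarith [sq_nonneg (‖u‖ - 1)]

lemma gaussianSmooth_eq_integral {d : ℕ} (σ : ℝ) (g : EuclideanSpace ℝ (Fin d) → ℝ)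
    (x : EuclideanSpace ℝ (Fin d)) :
    gaussianSmooth σ g x = ∫ u, g (x + σ • u) ∂gaussMeasure d := by
  rw [gaussianSmooth, integral_gaussMeasure, ← integral_const_mul]
  congr 1 with u
  simp only [smul_eq_mul]
  ring

/-! ### Smoothing of Lipschitz functions -/

section Lipschitz

variable {d : ℕ} {V : Type*} [NormedAddCommGroup V] {C : ℝ}

lemma continuous_of_norm_sub_le {g : EuclideanSpace ℝ (Fin d) → V}
    (hg : ∀ x y, ‖g x - g y‖ ≤ C * ‖x - y‖) : Continuous g := by
  refine (LipschitzWith.of_dist_le_mul (K := C.toNNReal) fun x y => ?_).continuous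
  rw [dist_eq_norm, dist_eq_norm]
  exact (hg x y).trans (mul_le_mul_of_nonneg_right (Real.le_coe_toNNReal C) (norm_nonneg _))

lemma integrable_comp_add_smul {g : EuclideanSpace ℝ (Fin d) → V}
    (hg : ∀ x y, ‖g x - g y‖ ≤ C * ‖x - y‖) (σ : ℝ) (x : EuclideanSpace ℝ (Fin d)) :
    Integrable (fun u => g (x + σ • u)) (gaussMeasure d) := by
  have hc := continuous_of_norm_sub_le hg
  refine (((integrable_norm_gaussMeasure d).const_mul (|C| * |σ|)).add
    (integrable_const ‖g x‖)).mono' (by fun_prop) (ae_of_all _ fun u => ?_)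
  have h1 := hg (x + σ • u) x
  rw [add_sub_cancel_left, norm_smul, Real.norm_eq_abs] at h1
  have h2 : C * (|σ| * ‖u‖) ≤ |C| * (|σ| * ‖u‖) :=
    mul_le_mul_of_nonneg_right (le_abs_self C) (by positivity)
  have h3 := norm_le_norm_sub_add (g (x + σ • u)) (g x)
  simp only [Pi.add_apply]
  linarith

lemma norm_integral_comp_sub_le [NormedSpace ℝ V] {g : EuclideanSpace ℝ (Fin d) → V}
    (hg : ∀ x y, ‖g x - g y‖ ≤ C * ‖x - y‖) (σ : ℝ) (x y : EuclideanSpace ℝ (Fin d)) :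
    ‖∫ u, g (x + σ • u) ∂gaussMeasure d - ∫ u, g (y + σ • u) ∂gaussMeasure d‖
      ≤ C * ‖x - y‖ := by
  rw [← integral_sub (integrable_comp_add_smul hg σ x) (integrable_comp_add_smul hg σ y)]
  refine (norm_integral_le_of_norm_le (integrable_const (C * ‖x - y‖))
    (ae_of_all _ fun u => ?_)).trans (by simp)
  simpa using hg (x + σ • u) (y + σ • u)

lemma norm_integral_comp_sub_le_abs_sub [NormedSpace ℝ V] {g : EuclideanSpace ℝ (Fin d) → V}
    (hg : ∀ x y, ‖g x - g y‖ ≤ C * ‖x - y‖) (σ τ : ℝ) (x : EuclideanSpace ℝ (Fin d)) :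
    ‖∫ u, g (x + σ • u) ∂gaussMeasure d - ∫ u, g (x + τ • u) ∂gaussMeasure d‖
      ≤ C * (∫ u, ‖u‖ ∂gaussMeasure d) * |σ - τ| := by
  rw [← integral_sub (integrable_comp_add_smul hg σ x) (integrable_comp_add_smul hg τ x)]
  refine (norm_integral_le_of_norm_le
    ((integrable_norm_gaussMeasure d).const_mul (C * |σ - τ|))
    (ae_of_all _ fun u => ?_)).trans (by rw [integral_const_mul]; linarith)
  refine (hg (x + σ • u) (x + τ • u)).trans_eq ?_
  rw [add_sub_add_left_eq_sub, ← sub_smul, norm_smul, Real.norm_eq_abs, mul_assoc]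

lemma norm_gradient_le_of_norm_sub_le {g : EuclideanSpace ℝ (Fin d) → ℝ} (hC : 0 ≤ C)
    (hg : ∀ x y, ‖g x - g y‖ ≤ C * ‖x - y‖) (x : EuclideanSpace ℝ (Fin d)) :
    ‖gradient g x‖ ≤ C := by
  rw [gradient, LinearIsometryEquiv.norm_map]
  refine norm_fderiv_le_of_lip' ℝ hC (Eventually.of_forall fun y => hg y x)

lemma norm_sub_le_of_norm_gradient_le {g : EuclideanSpace ℝ (Fin d) → ℝ}
    (hd : Differentiable ℝ g) (hg : ∀ x, ‖gradient g x‖ ≤ C) (x y : EuclideanSpace ℝ (Fin d)) :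
    ‖g x - g y‖ ≤ C * ‖x - y‖ := by
  refine Convex.norm_image_sub_le_of_norm_fderiv_le (𝕜 := ℝ) (s := Set.univ)
    (fun z _ => hd z) (fun z _ => ?_) convex_univ (Set.mem_univ y) (Set.mem_univ x)
  rw [← toDual_gradient, LinearIsometryEquiv.norm_map]
  exact hg z

/-- The sample functions are Lipschitz but need not be L-smooth, so this differentiates under the
integral with the Lipschitz constant as dominating function. -/
lemma differentiable_gaussianSmooth {g : EuclideanSpace ℝ (Fin d) → ℝ}
    (hd : Differentiable ℝ g) (hg : ∀ x y, ‖g x - g y‖ ≤ C * ‖x - y‖) (σ : ℝ) :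
    Differentiable ℝ (gaussianSmooth σ g) := by
  intro x
  have hc := continuous_of_norm_sub_le hg
  have h := (hasFDerivAt_integral_of_dominated_loc_of_lip (μ := gaussMeasure d) (𝕜 := ℝ)
    (F := fun x u => g (x + σ • u)) (F' := fun u => fderiv ℝ g (x + σ • u)) (x₀ := x)
    (s := Set.univ) (bound := fun _ => |C|) univ_mem
    (Eventually.of_forall fun y => by fun_prop) (integrable_comp_add_smul hg σ x)
    ((measurable_fderiv ℝ g).comp (by fun_prop)).aestronglyMeasurable
    (ae_of_all _ fun u => ?_) (integrable_const _) (ae_of_all _ fun u => ?_)).2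
  · simpa only [← gaussianSmooth_eq_integral] using h.differentiableAt
  · refine LipschitzOnWith.of_dist_le_mul fun y _ z _ => ?_
    rw [dist_eq_norm, dist_eq_norm, Real.coe_nnabs, abs_abs]
    refine (hg _ _).trans ?_
    rw [add_sub_add_right_eq_sub]
    gcongr
    exact le_abs_self C
  · exact (hasFDerivAt_comp_add_right (σ • u)).2 (hd (x + σ • u)).hasFDerivAt

end Lipschitz

/-! ### Smoothing of L-smooth functions -/

section Smooth

variable {d : ℕ} {L C : ℝ} {f : EuclideanSpace ℝ (Fin d) → ℝ}

lemma IsLSmooth.abs (h : IsLSmooth L f) : IsLSmooth |L| f := fun x y =>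
  (h x y).trans (by gcongr; exact le_abs_self L)

/-- Test the gradient difference against a vector w of length ‖x-y‖ in its own direction. Expanding
f between x, y and y+w costs |L|/2 times (2² + 1 + 1)‖x-y‖², whence the factor 3. -/
lemma IsLSmooth.norm_gradient_sub_le (h : IsLSmooth L f) (x y : EuclideanSpace ℝ (Fin d)) :
    ‖gradient f x - gradient f y‖ ≤ 3 * |L| * ‖x - y‖ := by
  by_cases hxy : x = y
  · simp [hxy]
  by_cases hg : gradient f x = gradient f y
  · rw [hg, sub_self, norm_zero]; positivity
  have hr : 0 < ‖x - y‖ := norm_pos_iff.2 (sub_ne_zero.2 hxy)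
  set Δ := gradient f y - gradient f x with hΔ
  have hΔ0 : 0 < ‖Δ‖ := norm_pos_iff.2 (sub_ne_zero.2 (Ne.symm hg))
  set w : EuclideanSpace ℝ (Fin d) := (‖x - y‖ / ‖Δ‖) • Δ with hw
  have hwn : ‖w‖ = ‖x - y‖ := by
    rw [hw, norm_smul, Real.norm_of_nonneg (by positivity), div_mul_cancel₀ _ hΔ0.ne']
  have hΔw : inner ℝ Δ w = ‖x - y‖ * ‖Δ‖ := by
    rw [hw, inner_smul_right, real_inner_self_eq_norm_sq]
    field_simp
  have h1 := (abs_le.1 (h.abs x (y + w))).2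
  have h2 := (abs_le.1 (h.abs y (y + w))).1
  have h3 := (abs_le.1 (h.abs x y)).1
  have e1 : y + w - x = w + (y - x) := by abel
  rw [add_sub_cancel_left] at h2
  rw [e1, inner_add_right] at h1
  have h4 : ‖w + (y - x)‖ ≤ 2 * ‖x - y‖ := by
    refine (norm_add_le _ _).trans ?_
    rw [hwn, norm_sub_rev y x]; linarith
  have h5 : ‖w + (y - x)‖ ^ 2 ≤ (2 * ‖x - y‖) ^ 2 := by gcongr
  have h6 : |L| / 2 * ‖w + (y - x)‖ ^ 2 ≤ |L| / 2 * (2 * ‖x - y‖) ^ 2 := by gcongr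
  rw [hwn] at h2
  rw [norm_sub_rev y x] at h3
  have h7 : inner ℝ Δ w = inner ℝ (gradient f y) w - inner ℝ (gradient f x) w := by
    rw [hΔ, inner_sub_left]
  have h8 : ‖x - y‖ * ‖Δ‖ ≤ ‖x - y‖ * (3 * |L| * ‖x - y‖) := by
    rw [← hΔw, h7]; nlinarith
  rw [norm_sub_rev]
  exact le_of_mul_le_mul_left h8 hr

lemma hasGradientAt_of_abs_sub_le {g : EuclideanSpace ℝ (Fin d) → ℝ}
    {p x : EuclideanSpace ℝ (Fin d)}
    (h : ∀ y, |g y - g x - inner ℝ p (y - x)| ≤ C * ‖y - x‖ ^ 2) : HasGradientAt g p x := by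
  rw [hasGradientAt_iff_isLittleO]
  have h1 : (fun y => g y - g x - inner ℝ p (y - x)) =O[𝓝 x] fun y => ‖y - x‖ ^ 2 := by
    refine Asymptotics.IsBigO.of_bound C (Eventually.of_forall fun y => ?_)
    simpa using h y
  exact h1.trans_isLittleO (Asymptotics.isLittleO_pow_sub_sub x one_lt_two)

/-- Averaging the quadratic remainder bound over u keeps it quadratic. It therefore both identifies
the gradient of the smoothing and shows the smoothing to be |L|-smooth. -/
lemma IsLSmooth.abs_gaussianSmooth_sub_le (hL : IsLSmooth L f)
    (hC : ∀ x y, ‖f x - f y‖ ≤ C * ‖x - y‖) (σ : ℝ) (x y : EuclideanSpace ℝ (Fin d)) :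
    |gaussianSmooth σ f y - gaussianSmooth σ f x
      - inner ℝ (∫ u, gradient f (x + σ • u) ∂gaussMeasure d) (y - x)|
      ≤ |L| / 2 * ‖y - x‖ ^ 2 := by
  have hi := integrable_comp_add_smul hL.norm_gradient_sub_le σ x
  rw [gaussianSmooth_eq_integral, gaussianSmooth_eq_integral, real_inner_comm,
    ← integral_inner hi,
    ← integral_sub (integrable_comp_add_smul hC σ y) (integrable_comp_add_smul hC σ x),
    ← integral_sub ((integrable_comp_add_smul hC σ y).sub' (integrable_comp_add_smul hC σ x))
      (hi.const_inner (y - x)), ← Real.norm_eq_abs]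
  refine (norm_integral_le_of_norm_le (integrable_const (|L| / 2 * ‖y - x‖ ^ 2))
    (ae_of_all _ fun u => ?_)).trans (by simp)
  have := hL.abs (x + σ • u) (y + σ • u)
  rw [add_sub_add_right_eq_sub, real_inner_comm] at this
  exact this

lemma IsLSmooth.gradient_gaussianSmooth (hL : IsLSmooth L f)
    (hC : ∀ x y, ‖f x - f y‖ ≤ C * ‖x - y‖) (σ : ℝ) (x : EuclideanSpace ℝ (Fin d)) :
    gradient (gaussianSmooth σ f) x = ∫ u, gradient f (x + σ • u) ∂gaussMeasure d :=
  (hasGradientAt_of_abs_sub_le (hL.abs_gaussianSmooth_sub_le hC σ x)).gradient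

lemma IsLSmooth.gaussianSmooth (hL : IsLSmooth L f)
    (hC : ∀ x y, ‖f x - f y‖ ≤ C * ‖x - y‖) (σ : ℝ) : IsLSmooth |L| (gaussianSmooth σ f) := fun x y => by
  rw [hL.gradient_gaussianSmooth hC]
  exact hL.abs_gaussianSmooth_sub_le hC σ x y

lemma IsLSmooth.norm_gradient_gaussianSmooth_sub_le (hL : IsLSmooth L f)
    (hC : ∀ x y, ‖f x - f y‖ ≤ C * ‖x - y‖) (σ τ : ℝ) (x : EuclideanSpace ℝ (Fin d)) :
    ‖gradient (_root_.gaussianSmooth σ f) x - gradient (_root_.gaussianSmooth τ f) x‖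
      ≤ 3 * |L| * (∫ u, ‖u‖ ∂gaussMeasure d) * |σ - τ| := by
  rw [hL.gradient_gaussianSmooth hC, hL.gradient_gaussianSmooth hC]
  exact norm_integral_comp_sub_le_abs_sub hL.norm_gradient_sub_le σ τ x

/-- Pairing u with -u leaves a first-order term involving only ∇f(x+τu) - ∇f(x-τu), itself O(τ‖u‖).
What remains is of order |σ-τ|τ and (σ-τ)², both at most |σ²-τ²|. -/
lemma IsLSmooth.abs_gaussianSmooth_sub_le_sq_sub (hL : IsLSmooth L f)
    (hC : ∀ x y, ‖f x - f y‖ ≤ C * ‖x - y‖) (σ τ : ℝ) (hσ : 0 ≤ σ) (hτ : 0 ≤ τ)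
    (x : EuclideanSpace ℝ (Fin d)) :
    |_root_.gaussianSmooth σ f x - _root_.gaussianSmooth τ f x|
      ≤ 7 * |L| * (∫ u, ‖u‖ ^ 2 ∂gaussMeasure d) * |σ ^ 2 - τ ^ 2| := by
  have hi (σ : ℝ) := integrable_comp_add_smul hC σ x
  have hi' (σ : ℝ) : Integrable (fun u => f (x - σ • u)) (gaussMeasure d) := by
    simpa [sub_eq_add_neg] using integrable_comp_add_smul hC (-σ) x
  have key (σ : ℝ) : 2 * _root_.gaussianSmooth σ f x
      = ∫ u, (f (x + σ • u) + f (x - σ • u)) ∂gaussMeasure d := by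
    rw [integral_add (hi σ) (hi' σ), gaussianSmooth_eq_integral,
      ← integral_neg_gaussMeasure (fun u => f (x - σ • u))]
    simp only [smul_neg, sub_neg_eq_add]
    ring
  have h2 : |2 * _root_.gaussianSmooth σ f x - 2 * _root_.gaussianSmooth τ f x|
      ≤ 7 * |L| * |σ ^ 2 - τ ^ 2| * (∫ u, ‖u‖ ^ 2 ∂gaussMeasure d) := by
    rw [key, key, ← integral_sub ((hi σ).fun_add (hi' σ)) ((hi τ).fun_add (hi' τ)),
      ← integral_const_mul, ← Real.norm_eq_abs]
    refine norm_integral_le_of_norm_le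
      ((integrable_norm_sq_gaussMeasure d).const_mul _) (ae_of_all _ fun u => ?_)
    rw [Real.norm_eq_abs]
    have a1 := abs_le.1 (hL.abs (x + τ • u) (x + σ • u))
    have a2 := abs_le.1 (hL.abs (x - τ • u) (x - σ • u))
    have e1 : x + σ • u - (x + τ • u) = (σ - τ) • u := by module
    have e2 : x - σ • u - (x - τ • u) = (-(σ - τ)) • u := by module
    rw [e1, inner_smul_right, norm_smul, mul_pow, Real.norm_eq_abs, sq_abs] at a1
    rw [e2, inner_smul_right, norm_smul, mul_pow, Real.norm_eq_abs, sq_abs, neg_sq] at a2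
    have b1 := hL.norm_gradient_sub_le (x + τ • u) (x - τ • u)
    have e3 : x + τ • u - (x - τ • u) = (2 * τ) • u := by module
    rw [e3, norm_smul, Real.norm_of_nonneg (by positivity)] at b1
    have b2 := abs_real_inner_le_norm (gradient f (x + τ • u) - gradient f (x - τ • u)) u
    have b3 : |(σ - τ) * inner ℝ (gradient f (x + τ • u) - gradient f (x - τ • u)) u|
        ≤ |σ - τ| * (3 * |L| * (2 * τ * ‖u‖) * ‖u‖) := by
      rw [abs_mul]
      gcongr
      exact b2.trans (by gcongr)
    rw [inner_sub_left] at b3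
    have b3' := abs_le.1 b3
    have c0 : |σ ^ 2 - τ ^ 2| = |σ - τ| * (σ + τ) := by
      rw [show σ ^ 2 - τ ^ 2 = (σ - τ) * (σ + τ) by ring, abs_mul, abs_of_nonneg (add_nonneg hσ hτ)]
    have c1 : |σ - τ| * τ ≤ |σ ^ 2 - τ ^ 2| := by
      rw [c0]; gcongr; linarith
    have c2 : (σ - τ) ^ 2 ≤ |σ ^ 2 - τ ^ 2| := by
      rw [c0, ← sq_abs, sq]; gcongr
      exact abs_le.2 ⟨by linarith, by linarith⟩
    have d1 : |L| * ‖u‖ ^ 2 * (|σ - τ| * τ) ≤ |L| * ‖u‖ ^ 2 * |σ ^ 2 - τ ^ 2| := by gcongr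
    have d2 : |L| * ‖u‖ ^ 2 * (σ - τ) ^ 2 ≤ |L| * ‖u‖ ^ 2 * |σ ^ 2 - τ ^ 2| := by gcongr
    rw [abs_le]
    constructor <;> nlinarith
  rw [← mul_sub, abs_mul, abs_two] at h2
  have h3 : 0 ≤ |_root_.gaussianSmooth σ f x - _root_.gaussianSmooth τ f x| := abs_nonneg _
  linarith

lemma le_gaussianSmooth (hC : ∀ x y, ‖f x - f y‖ ≤ C * ‖x - y‖) {b : ℝ} (hb : ∀ x, b ≤ f x) (σ : ℝ) (x : EuclideanSpace ℝ (Fin d)) :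
    b ≤ _root_.gaussianSmooth σ f x := by
  rw [gaussianSmooth_eq_integral]
  calc b = ∫ _, b ∂gaussMeasure d := by simp
    _ ≤ _ := integral_mono (integrable_const b) (integrable_comp_add_smul hC σ x) fun u => hb _

end Smooth

/-! ### Real sequences and momentum weights -/

section Sequences

/-- A nonnegative sequence with increments of order `η` and `∑ η a < ∞`, `∑ η = ∞` tends to `0`. -/
lemma tendsto_zero_of_summable_mul {η a : ℕ → ℝ} {C : ℝ} (hη : ∀ n, 0 ≤ η n) (ha : ∀ n, 0 ≤ a n)
    (hη0 : Tendsto η atTop (𝓝 0)) (hdiv : ¬ Summable η) (hs : Summable fun n => η n * a n)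
    (hC : ∀ n, |a (n + 1) - a n| ≤ C * η n) : Tendsto a atTop (𝓝 0) := by
  have hC0 : ∀ n, |a (n + 1) - a n| ≤ |C| * η n := fun n =>
    (hC n).trans (mul_le_mul_of_nonneg_right (le_abs_self C) (hη n))
  rw [Metric.tendsto_atTop]
  intro e he
  obtain ⟨δ, hδ, rfl⟩ : ∃ δ > 0, e = 2 * δ := ⟨e / 2, by positivity, by ring⟩
  have h1 : ∀ᶠ n in atTop, |C| * η n < δ / 2 := by
    have := hη0.const_mul |C|
    rw [mul_zero] at this
    exact this.eventually_lt_const (by positivity)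
  have h2 : ∀ᶠ n in atTop, 2 * |C| / δ * (∑' i, η i * a i - ∑ i ∈ Finset.range n, η i * a i) < δ := by
    have := (hs.hasSum.tendsto_sum_nat.const_sub (∑' i, η i * a i)).const_mul (2 * |C| / δ)
    rw [sub_self, mul_zero] at this
    exact this.eventually_lt_const hδ
  -- Otherwise η ≤ δ⁻¹ η a eventually, and ∑ η would converge.
  have h3 : ∃ᶠ n in atTop, a n < δ := by
    intro h
    refine hdiv ((hs.mul_left δ⁻¹).of_norm_bounded_eventually_nat ?_)
    filter_upwards [h] with n hn
    rw [Real.norm_of_nonneg (hη n), ← div_eq_inv_mul, le_div_iff₀ hδ]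
    exact mul_le_mul_of_nonneg_left (not_lt.1 hn) (hη n)
  obtain ⟨N, hN⟩ := eventually_atTop.1 h1
  obtain ⟨n₀, hn₀, h4, h5⟩ := (h3.and_eventually (h2.and (eventually_ge_atTop N))).exists
  -- Above δ/2 an increment |C| η is at most (2|C|/δ) η a, which is paid for by the summable series;
  -- below δ/2 one step is too short to pass δ.
  have key : ∀ n ≥ n₀, max (a n) δ ≤ max (a n₀) δ + 2 * |C| / δ *
      (∑ i ∈ Finset.range n, η i * a i - ∑ i ∈ Finset.range n₀, η i * a i) := by
    intro n hn
    induction n, hn using Nat.le_induction with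
    | base => simp
    | succ n hn ih =>
      rw [Finset.sum_range_succ]
      have hCn := hN n (h5.trans hn)
      have h6 := (abs_le.1 (hC0 n)).2
      have h7 : 0 ≤ 2 * |C| / δ * (η n * a n) := by
        have := hη n; have := ha n; positivity
      suffices max (a (n + 1)) δ ≤ max (a n) δ + 2 * |C| / δ * (η n * a n) by
        rw [add_sub_right_comm, mul_add]; linarith
      rcases lt_or_ge (a n) (δ / 2) with h8 | h8
      · have : a (n + 1) ≤ δ := by linarith
        rw [max_eq_right this]
        linarith [le_max_right (a n) δ]
      · have h9 : |C| * η n ≤ 2 * |C| / δ * (η n * a n) := by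
          have : 2 * |C| / δ * (η n * a n) = |C| * η n * (a n / (δ / 2)) := by
            field_simp
          rw [this]
          refine le_mul_of_one_le_right (mul_nonneg (abs_nonneg _) (hη n)) ?_
          rwa [one_le_div (by positivity)]
        refine max_le ?_ ?_
        · linarith [le_max_left (a n) δ]
        · linarith [le_max_right (a n) δ]
  refine ⟨n₀, fun n hn => ?_⟩
  rw [Real.dist_eq, sub_zero, abs_of_nonneg (ha n)]
  have h6 := key n hn
  rw [max_eq_right hn₀.le] at h6
  have h7 : ∑ i ∈ Finset.range n, η i * a i ≤ ∑' i, η i * a i :=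
    hs.sum_le_tsum _ fun i _ => mul_nonneg (hη i) (ha i)
  have h8 : 2 * |C| / δ * (∑ i ∈ Finset.range n, η i * a i - ∑ i ∈ Finset.range n₀, η i * a i)
      ≤ 2 * |C| / δ * (∑' i, η i * a i - ∑ i ∈ Finset.range n₀, η i * a i) := by gcongr
  linarith [le_max_left (a n) δ]

/-- Take w_t = ∑_n η_{t+n} β_{t+1}⋯β_{t+n}, the total step size with which a gradient entering at
time t acts later. Splitting off n = 0 gives the recursion; `hR` and a geometric series give the
upper bound. -/
lemma exists_momentum_weights {η β : ℕ → ℝ} {βmax R : ℝ}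
    (hη : ∀ t ≥ 1, 0 < η t) (hβ : ∀ t ≥ 1, 0 ≤ β t ∧ β t ≤ βmax) (hβmax : βmax < 1)
    (hR : ∀ t ≥ 1, ∀ n, η (t + n) ≤ R * η t) :
    ∃ w : ℕ → ℝ, ∃ C : ℝ, 0 ≤ C ∧ ∀ t ≥ 1,
      w t = η t + β (t + 1) * w (t + 1) ∧ η t ≤ w t ∧ w t ≤ C * η t := by
  have hβ0 : 0 ≤ βmax := (hβ 1 le_rfl).1.trans (hβ 1 le_rfl).2
  have hR0 : 0 ≤ R := by
    by_contra! h
    have h1 := hη 1 le_rfl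
    have h2 := hR 1 le_rfl 0
    rw [add_zero] at h2
    nlinarith
  set c : ℕ → ℕ → ℝ := fun t n => η (t + n) * ∏ r ∈ Finset.range n, β (t + (r + 1)) with hc
  have hprod (t n : ℕ) : 0 ≤ ∏ r ∈ Finset.range n, β (t + (r + 1)) :=
    Finset.prod_nonneg fun r _ => (hβ _ (by omega)).1
  have hprod' (t n : ℕ) : ∏ r ∈ Finset.range n, β (t + (r + 1)) ≤ βmax ^ n := by
    refine (Finset.prod_le_prod (fun r _ => (hβ _ (by omega)).1)
      fun r _ => (hβ (t + (r + 1)) (by omega)).2).trans (by simp)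
  have hc0 (t n : ℕ) (ht : 1 ≤ t) : 0 ≤ c t n :=
    mul_nonneg (hη _ (by omega)).le (hprod t n)
  have hcb (t n : ℕ) (ht : 1 ≤ t) : c t n ≤ R * η t * βmax ^ n :=
    mul_le_mul (hR t ht n) (hprod' t n) (hprod t n) (mul_nonneg hR0 (hη t ht).le)
  have hgeo (t : ℕ) : Summable fun n => R * η t * βmax ^ n :=
    (summable_geometric_of_lt_one hβ0 hβmax).mul_left _
  have hcs (t : ℕ) (ht : 1 ≤ t) : Summable (c t) :=
    (hgeo t).of_nonneg_of_le (fun n => hc0 t n ht) fun n => hcb t n ht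
  have hsucc (t n : ℕ) : c t (n + 1) = β (t + 1) * c (t + 1) n := by
    simp only [hc, Finset.prod_range_succ']
    rw [show t + (n + 1) = t + 1 + n by omega, zero_add]
    have : ∀ r, t + (r + 1 + 1) = t + 1 + (r + 1) := fun r => by omega
    simp only [this]
    ring
  have hrec (t : ℕ) (ht : 1 ≤ t) : ∑' n, c t n = η t + β (t + 1) * ∑' n, c (t + 1) n := by
    rw [(hcs t ht).tsum_eq_zero_add]
    simp only [hsucc]
    rw [tsum_mul_left]
    simp [hc]
  refine ⟨fun t => ∑' n, c t n, R * (1 - βmax)⁻¹,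
    mul_nonneg hR0 (inv_nonneg.2 (by linarith)), fun t ht => ⟨hrec t ht, ?_, ?_⟩⟩
  · have h1 : 0 ≤ ∑' n, c (t + 1) n := tsum_nonneg fun n => hc0 (t + 1) n (by omega)
    have := mul_nonneg (hβ (t + 1) (by omega)).1 h1
    change η t ≤ ∑' n, c t n
    rw [hrec t ht]; linarith
  · calc ∑' n, c t n ≤ ∑' n, R * η t * βmax ^ n :=
          (hcs t ht).tsum_le_tsum (fun n => hcb t n ht) (hgeo t)
      _ = R * (1 - βmax)⁻¹ * η t := by
          rw [tsum_mul_left, tsum_geometric_of_lt_one hβ0 hβmax]; ring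

end Sequences

/-! ### Diagonal scaling -/

section DiagScale

variable {d : ℕ}

/-- Coordinate-wise multiplication of vectors of `ℝ^d` by `D`. -/
def diagScale (D : Fin d → ℝ) : EuclideanSpace ℝ (Fin d) →ₗ[ℝ] EuclideanSpace ℝ (Fin d) where
  toFun m := WithLp.toLp 2 fun i => D i * m i
  map_add' m n := by ext i; simp [mul_add]
  map_smul' c m := by ext i; simp [mul_left_comm]

@[simp] lemma diagScale_apply (D : Fin d → ℝ) (m : EuclideanSpace ℝ (Fin d)) (i : Fin d) :
    diagScale D m i = D i * m i := rfl

lemma norm_diagScale_le {D : Fin d → ℝ} {B : ℝ} (hB : 0 ≤ B) (hD : ∀ i, |D i| ≤ B)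
    (m : EuclideanSpace ℝ (Fin d)) : ‖diagScale D m‖ ≤ B * ‖m‖ := by
  rw [← sq_le_sq₀ (norm_nonneg _) (by positivity), mul_pow, EuclideanSpace.real_norm_sq_eq,
    EuclideanSpace.real_norm_sq_eq, Finset.mul_sum]
  refine Finset.sum_le_sum fun i _ => ?_
  rw [diagScale_apply, mul_pow]
  have : D i ^ 2 ≤ B ^ 2 := by
    rw [← sq_abs]; exact pow_le_pow_left₀ (abs_nonneg _) (hD i) 2
  gcongr

lemma abs_inner_diagScale_le {D : Fin d → ℝ} {B : ℝ} (hB : 0 ≤ B) (hD : ∀ i, |D i| ≤ B)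
    (p m : EuclideanSpace ℝ (Fin d)) : |inner ℝ p (diagScale D m)| ≤ B * ‖p‖ * ‖m‖ := by
  refine (abs_real_inner_le_norm _ _).trans ?_
  have := mul_le_mul_of_nonneg_left (norm_diagScale_le hB hD m) (norm_nonneg p)
  linarith

lemma le_inner_diagScale_self {D : Fin d → ℝ} {b : ℝ} (hD : ∀ i, b ≤ D i)
    (p : EuclideanSpace ℝ (Fin d)) : b * ‖p‖ ^ 2 ≤ inner ℝ p (diagScale D p) := by
  rw [EuclideanSpace.real_norm_sq_eq, Finset.mul_sum, PiLp.inner_apply]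
  refine Finset.sum_le_sum fun i _ => ?_
  have := mul_le_mul_of_nonneg_right (hD i) (sq_nonneg (p i))
  simp only [diagScale_apply, RCLike.inner_apply, conj_trivial]
  linarith

end DiagScale

/-! ### One step of Adam -/

section Adam

variable {d : ℕ}

/-- The coordinate-wise preconditioner `1 / √(v + ε)`. -/
def precond (ε : ℝ) (v : EuclideanSpace ℝ (Fin d)) (i : Fin d) : ℝ := 1 / Real.sqrt (v i + ε)

lemma adamStep_x (η β θ ε : ℝ) (g : EuclideanSpace ℝ (Fin d)) (s : AdamState d) :
    (adamStep η β θ ε g s).x = s.x - η • diagScale (precond ε (adamStep η β θ ε g s).v)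
      (adamStep η β θ ε g s).m := by
  ext i
  simp only [adamStep, precond, PiLp.sub_apply, PiLp.smul_apply, diagScale_apply, smul_eq_mul]
  ring

lemma adamStep_m (η β θ ε : ℝ) (g : EuclideanSpace ℝ (Fin d)) (s : AdamState d) :
    (adamStep η β θ ε g s).m = β • s.m + (1 - β) • g := rfl

lemma adamStep_v (η β θ ε : ℝ) (g : EuclideanSpace ℝ (Fin d)) (s : AdamState d) (i : Fin d) :
    (adamStep η β θ ε g s).v i = θ * s.v i + (1 - θ) * g i ^ 2 := rfl

lemma precond_pos {ε : ℝ} (hε : 0 < ε) {v : EuclideanSpace ℝ (Fin d)} {i : Fin d}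
    (hv : 0 ≤ v i) : 0 < precond ε v i := by
  rw [precond]; positivity

lemma abs_precond_le {ε : ℝ} (hε : 0 < ε) {v : EuclideanSpace ℝ (Fin d)} {i : Fin d}
    (hv : 0 ≤ v i) : |precond ε v i| ≤ 1 / Real.sqrt ε := by
  rw [abs_of_pos (precond_pos hε hv), precond]
  gcongr
  linarith

/-- With a = √(v+ε) and b = √(v'+ε), the difference of reciprocals is (a²-b²)/(ab(a+b)), and all
factors below are at least √ε. -/
lemma abs_precond_sub_le {ε : ℝ} (hε : 0 < ε) {v v' : EuclideanSpace ℝ (Fin d)} {i : Fin d}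
    (hv : 0 ≤ v i) (hv' : 0 ≤ v' i) :
    |precond ε v' i - precond ε v i| ≤ 1 / (ε * Real.sqrt ε) * |v' i - v i| := by
  have h0 : 0 < Real.sqrt ε := Real.sqrt_pos.2 hε
  set a := Real.sqrt (v i + ε) with ha
  set b := Real.sqrt (v' i + ε) with hb
  have ha1 : Real.sqrt ε ≤ a := Real.sqrt_le_sqrt (by linarith)
  have hb1 : Real.sqrt ε ≤ b := Real.sqrt_le_sqrt (by linarith)
  have ha2 : a ^ 2 = v i + ε := Real.sq_sqrt (by linarith)
  have hb2 : b ^ 2 = v' i + ε := Real.sq_sqrt (by linarith)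
  have ha0 : 0 < a := h0.trans_le ha1
  have hb0 : 0 < b := h0.trans_le hb1
  have e1 : v' i - v i = (b - a) * (b + a) := by linarith [ha2, hb2, sq_sub_sq b a]
  have e2 : precond ε v' i - precond ε v i = (a - b) / (a * b) := by
    simp only [precond, ← ha, ← hb]; field_simp
  rw [e1, e2, abs_div, abs_mul (b - a), abs_of_pos (mul_pos ha0 hb0), abs_sub_comm a b,
    abs_of_pos (add_pos hb0 ha0), div_le_iff₀ (mul_pos ha0 hb0)]
  have h1 : ε * Real.sqrt ε ≤ (b + a) * (a * b) := by
    have : ε = Real.sqrt ε * Real.sqrt ε := (Real.mul_self_sqrt hε.le).symm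
    have h2 : ε ≤ a * b := by rw [this]; gcongr
    rw [mul_comm ε]
    gcongr
    linarith
  have h2 : 1 ≤ (b + a) * (a * b) / (ε * Real.sqrt ε) := by
    rwa [one_le_div (by positivity)]
  calc |b - a| ≤ |b - a| * ((b + a) * (a * b) / (ε * Real.sqrt ε)) :=
        le_mul_of_one_le_right (abs_nonneg _) h2
    _ = _ := by ring

/-- The state after a step of Adam with bounded gradients stays bounded. -/
lemma adamStep_bounds {η β θ ε G : ℝ} {g : EuclideanSpace ℝ (Fin d)} {s : AdamState d}
    (hβ : 0 ≤ β ∧ β ≤ 1) (hθ : 0 ≤ θ ∧ θ ≤ 1) (hg : ‖g‖ ≤ G)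
    (hm : ‖s.m‖ ≤ G) (hv : ∀ i, 0 ≤ s.v i ∧ s.v i ≤ G ^ 2) :
    ‖(adamStep η β θ ε g s).m‖ ≤ G ∧
      (∀ i, 0 ≤ (adamStep η β θ ε g s).v i ∧ (adamStep η β θ ε g s).v i ≤ G ^ 2) ∧
      ∀ i, |(adamStep η β θ ε g s).v i - s.v i| ≤ (1 - θ) * G ^ 2 := by
  have h1 : 0 ≤ 1 - β := by linarith [hβ.2]
  have h2 : 0 ≤ 1 - θ := by linarith [hθ.2]
  have hgi (i : Fin d) : g i ^ 2 ≤ G ^ 2 := by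
    rw [← sq_abs, ← Real.norm_eq_abs]
    exact pow_le_pow_left₀ (norm_nonneg _) ((PiLp.norm_apply_le g i).trans hg) 2
  refine ⟨?_, fun i => ?_, fun i => ?_⟩
  · rw [adamStep_m]
    refine (norm_add_le _ _).trans ?_
    rw [norm_smul, norm_smul, Real.norm_of_nonneg hβ.1, Real.norm_of_nonneg h1]
    nlinarith [mul_le_mul_of_nonneg_left hm hβ.1, mul_le_mul_of_nonneg_left hg h1]
  · rw [adamStep_v]
    refine ⟨add_nonneg (mul_nonneg hθ.1 (hv i).1) (mul_nonneg h2 (sq_nonneg _)), ?_⟩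
    nlinarith [mul_le_mul_of_nonneg_left (hv i).2 hθ.1, mul_le_mul_of_nonneg_left (hgi i) h2]
  · rw [adamStep_v, show θ * s.v i + (1 - θ) * g i ^ 2 - s.v i = (1 - θ) * (g i ^ 2 - s.v i) by ring,
      abs_mul, abs_of_nonneg h2]
    refine mul_le_mul_of_nonneg_left (abs_le.2 ⟨?_, ?_⟩) h2
    · linarith [(hv i).2, sq_nonneg (g i)]
    · linarith [(hv i).1, hgi i]

end Adam

/-! ### Descent along a trajectory -/

section Trajectory

variable {d : ℕ}

/-- The gradient of the next objective `φ (t + 1)` at the iterate after `t` steps. -/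
def nextGrad (φ : ℕ → EuclideanSpace ℝ (Fin d) → ℝ) (s : ℕ → AdamState d) (t : ℕ) :
    EuclideanSpace ℝ (Fin d) :=
  gradient (φ (t + 1)) (s t).x

/-- The derivative of the objective along the direction of the last step. -/
def momentumSlope (φ : ℕ → EuclideanSpace ℝ (Fin d) → ℝ) (ε : ℝ) (s : ℕ → AdamState d)
    (t : ℕ) : ℝ :=
  inner ℝ (nextGrad φ s (t - 1)) (diagScale (precond ε (s t).v) (s t).m)

/-- A Lyapunov function for Adam: the objective corrected by the weighted momentum slope. -/
def adamLyapunov (φ : ℕ → EuclideanSpace ℝ (Fin d) → ℝ) (β w : ℕ → ℝ) (ε : ℝ)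
    (s : ℕ → AdamState d) (t : ℕ) : ℝ :=
  φ (t + 1) (s t).x - β (t + 1) * w (t + 1) * momentumSlope φ ε s t

variable {s : ℕ → AdamState d} {g : ℕ → EuclideanSpace ℝ (Fin d)}
  {φ : ℕ → EuclideanSpace ℝ (Fin d) → ℝ} {η β θ w : ℕ → ℝ} {ε G L C₁ C₂ Cw : ℝ}

lemma adam_bounded (hm : (s 0).m = 0) (hv : (s 0).v = 0)
    (hs : ∀ t, s (t + 1) = adamStep (η (t + 1)) (β (t + 1)) (θ (t + 1)) ε (g t) (s t))
    (hβ : ∀ t ≥ 1, 0 ≤ β t ∧ β t ≤ 1) (hθ : ∀ t ≥ 1, 0 ≤ θ t ∧ θ t ≤ 1) (hg : ∀ t, ‖g t‖ ≤ G)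
    (t : ℕ) : ‖(s t).m‖ ≤ G ∧ ∀ i, 0 ≤ (s t).v i ∧ (s t).v i ≤ G ^ 2 := by
  induction t with
  | zero =>
    have := (norm_nonneg _).trans (hg 0)
    simp [hm, hv, this]
  | succ t ih =>
    have := adamStep_bounds (η := η (t + 1)) (ε := ε) (hβ (t + 1) (by omega))
      (hθ (t + 1) (by omega)) (hg t) ih.1 ih.2
    rw [hs]
    exact ⟨this.1, this.2.1⟩

lemma norm_adam_step_le (hε : 0 < ε) (hη : ∀ t ≥ 1, 0 < η t) (hm : (s 0).m = 0) (hv : (s 0).v = 0)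
    (hs : ∀ t, s (t + 1) = adamStep (η (t + 1)) (β (t + 1)) (θ (t + 1)) ε (g t) (s t))
    (hβ : ∀ t ≥ 1, 0 ≤ β t ∧ β t ≤ 1) (hθ : ∀ t ≥ 1, 0 ≤ θ t ∧ θ t ≤ 1) (hg : ∀ t, ‖g t‖ ≤ G)
    (t : ℕ) : ‖(s (t + 1)).x - (s t).x‖ ≤ η (t + 1) * (1 / Real.sqrt ε * G) := by
  have hb := adam_bounded hm hv hs hβ hθ hg (t + 1)
  rw [show (s (t + 1)).x - (s t).x = -(η (t + 1) • diagScale (precond ε (s (t + 1)).v)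
    (s (t + 1)).m) by rw [hs, adamStep_x]; abel, norm_neg, norm_smul,
    Real.norm_of_nonneg (hη _ (by omega)).le]
  refine mul_le_mul_of_nonneg_left ?_ (hη _ (by omega)).le
  refine (norm_diagScale_le (by positivity) (fun i => abs_precond_le hε (hb.2 i).1) _).trans ?_
  gcongr
  exact hb.1

lemma norm_nextGrad_sub_le (hε : 0 < ε) (hη : ∀ t ≥ 1, 0 < η t) (hm : (s 0).m = 0)
    (hv : (s 0).v = 0)
    (hs : ∀ t, s (t + 1) = adamStep (η (t + 1)) (β (t + 1)) (θ (t + 1)) ε (g t) (s t))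
    (hβ : ∀ t ≥ 1, 0 ≤ β t ∧ β t ≤ 1) (hθ : ∀ t ≥ 1, 0 ≤ θ t ∧ θ t ≤ 1) (hg : ∀ t, ‖g t‖ ≤ G)
    (hφ : ∀ t, IsLSmooth L (φ t))
    (hφ' : ∀ t ≥ 1, ∀ x, ‖gradient (φ (t + 1)) x - gradient (φ t) x‖ ≤ C₂ * η t) (t : ℕ) :
    ‖nextGrad φ s (t + 1) - nextGrad φ s t‖
      ≤ (C₂ + 3 * |L| * (1 / Real.sqrt ε * G)) * η (t + 1) := by
  have h1 := hφ' (t + 1) (by omega) (s (t + 1)).x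
  have h2 := (hφ (t + 1)).norm_gradient_sub_le (s (t + 1)).x (s t).x
  have h3 := norm_adam_step_le hε hη hm hv hs hβ hθ hg t
  have h4 : 3 * |L| * ‖(s (t + 1)).x - (s t).x‖
      ≤ 3 * |L| * (η (t + 1) * (1 / Real.sqrt ε * G)) := by gcongr
  have h5 := norm_sub_le_norm_sub_add_norm_sub (gradient (φ (t + 1 + 1)) (s (t + 1)).x)
    (gradient (φ (t + 1)) (s (t + 1)).x) (gradient (φ (t + 1)) (s t).x)
  rw [nextGrad, nextGrad]
  linarith

lemma abs_momentumSlope_le (hε : 0 < ε) (hm : (s 0).m = 0) (hv : (s 0).v = 0)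
    (hs : ∀ t, s (t + 1) = adamStep (η (t + 1)) (β (t + 1)) (θ (t + 1)) ε (g t) (s t))
    (hβ : ∀ t ≥ 1, 0 ≤ β t ∧ β t ≤ 1) (hθ : ∀ t ≥ 1, 0 ≤ θ t ∧ θ t ≤ 1) (hg : ∀ t, ‖g t‖ ≤ G)
    (hφG : ∀ t x, ‖gradient (φ t) x‖ ≤ G) (t : ℕ) :
    |momentumSlope φ ε s t| ≤ 1 / Real.sqrt ε * G * G := by
  have hb := adam_bounded hm hv hs hβ hθ hg t
  have hG := (norm_nonneg _).trans (hg 0)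
  refine (abs_inner_diagScale_le (by positivity)
    (fun i => abs_precond_le hε (hb.2 i).1) _ _).trans ?_
  gcongr
  · exact hφG _ _
  · exact hb.1

/-- The preconditioner is frozen at time t so that it does not see the next sample; this costs
O(1-θ_{t+1}). Replacing the previous gradient by the current one costs O(η_t). -/
lemma momentumSlope_succ_ge (hε : 0 < ε) (hη : ∀ t ≥ 1, 0 < η t) (hm : (s 0).m = 0)
    (hv : (s 0).v = 0)
    (hs : ∀ t, s (t + 1) = adamStep (η (t + 1)) (β (t + 1)) (θ (t + 1)) ε (g t) (s t))
    (hβ : ∀ t ≥ 1, 0 ≤ β t ∧ β t ≤ 1) (hθ : ∀ t ≥ 1, 0 ≤ θ t ∧ θ t ≤ 1) (hg : ∀ t, ‖g t‖ ≤ G)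
    (hφ : ∀ t, IsLSmooth L (φ t)) (hφG : ∀ t x, ‖gradient (φ t) x‖ ≤ G) (hC₂ : 0 ≤ C₂)
    (hφ' : ∀ t ≥ 1, ∀ x, ‖gradient (φ (t + 1)) x - gradient (φ t) x‖ ≤ C₂ * η t) (t : ℕ) :
    β (t + 1) * momentumSlope φ ε s t
      + (1 - β (t + 1)) * inner ℝ (nextGrad φ s t) (diagScale (precond ε (s t).v) (g t))
      - (1 / (ε * Real.sqrt ε) * G ^ 4 * (1 - θ (t + 1))
        + 1 / Real.sqrt ε * G * (C₂ + 3 * |L| * (1 / Real.sqrt ε * G)) * |η t|)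
      ≤ momentumSlope φ ε s (t + 1) := by
  have hb := adam_bounded hm hv hs hβ hθ hg
  have hG := (norm_nonneg _).trans (hg 0)
  have hp : ‖nextGrad φ s t‖ ≤ G := hφG _ _
  have hβt := hβ (t + 1) (by omega)
  have hθt := hθ (t + 1) (by omega)
  have hstep := adamStep_bounds (η := η (t + 1)) (ε := ε) hβt hθt (hg t) (hb t).1 (hb t).2
  rw [← hs] at hstep
  set p := nextGrad φ s t with hpdef
  set A := diagScale (precond ε (s t).v) with hA
  -- For t = 0 truncated subtraction makes the difference vanish; the absolute value is there
  -- because nothing is known about the sign of `η 0`.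
  have hdiff : ‖p - nextGrad φ s (t - 1)‖
      ≤ (C₂ + 3 * |L| * (1 / Real.sqrt ε * G)) * |η t| := by
    rcases t with _ | t
    · simp only [hpdef, zero_le, Nat.sub_eq_zero_of_le, sub_self, norm_zero]
      positivity
    · rw [abs_of_pos (hη _ (by omega))]
      exact norm_nextGrad_sub_le hε hη hm hv hs hβ hθ hg hφ hφ' t
  have h1 : |inner ℝ (p - nextGrad φ s (t - 1)) (A (s t).m)|
      ≤ 1 / Real.sqrt ε * ((C₂ + 3 * |L| * (1 / Real.sqrt ε * G)) * |η t|) * G := by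
    refine (abs_inner_diagScale_le (by positivity)
      (fun i => abs_precond_le hε ((hb t).2 i).1) _ _).trans ?_
    gcongr
    exact (hb t).1
  have h2 : |inner ℝ p (diagScale (fun i => precond ε (s (t + 1)).v i - precond ε (s t).v i)
      (s (t + 1)).m)| ≤ 1 / (ε * Real.sqrt ε) * ((1 - θ (t + 1)) * G ^ 2) * G * G := by
    have h0 : 0 ≤ 1 - θ (t + 1) := by linarith
    refine (abs_inner_diagScale_le
      (B := 1 / (ε * Real.sqrt ε) * ((1 - θ (t + 1)) * G ^ 2)) (by positivity)
      (fun i => (abs_precond_sub_le hε ((hb t).2 i).1 (hstep.2.1 i).1).trans ?_) _ _).trans ?_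
    · gcongr
      exact hstep.2.2 i
    · gcongr
      exact hstep.1
  have e1 : momentumSlope φ ε s (t + 1) = inner ℝ p (A (s (t + 1)).m)
      + inner ℝ p (diagScale (fun i => precond ε (s (t + 1)).v i - precond ε (s t).v i)
        (s (t + 1)).m) := by
    rw [momentumSlope, ← inner_add_right, Nat.add_sub_cancel, ← hpdef]
    congr 1
    ext i
    simp only [diagScale_apply, PiLp.add_apply, hA]
    ring
  have e2 : inner ℝ p (A (s (t + 1)).m)
      = β (t + 1) * (momentumSlope φ ε s t + inner ℝ (p - nextGrad φ s (t - 1)) (A (s t).m))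
        + (1 - β (t + 1)) * inner ℝ p (A (g t)) := by
    rw [hs, adamStep_m, map_add, map_smul, map_smul, inner_add_right, inner_smul_right,
      inner_smul_right, inner_sub_left, momentumSlope, ← hA]
    ring
  rw [e1, e2]
  have h3 := (abs_le.1 h1).1
  have h4 := (abs_le.1 h2).1
  have h5 : -(1 / Real.sqrt ε * ((C₂ + 3 * |L| * (1 / Real.sqrt ε * G)) * |η t|) * G)
      ≤ β (t + 1) * inner ℝ (p - nextGrad φ s (t - 1)) (A (s t).m) := by
    have h6 : |β (t + 1) * inner ℝ (p - nextGrad φ s (t - 1)) (A (s t).m)|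
        ≤ 1 / Real.sqrt ε * ((C₂ + 3 * |L| * (1 / Real.sqrt ε * G)) * |η t|) * G := by
      rw [abs_mul, abs_of_nonneg hβt.1]
      exact (mul_le_of_le_one_left (abs_nonneg _) hβt.2).trans h1
    exact (abs_le.1 h6).1
  linarith

/-- One step of Adam decreases the Lyapunov function up to summable errors. -/
lemma adamLyapunov_succ_le (hε : 0 < ε) (hη : ∀ t ≥ 1, 0 < η t) (hm : (s 0).m = 0)
    (hv : (s 0).v = 0)
    (hs : ∀ t, s (t + 1) = adamStep (η (t + 1)) (β (t + 1)) (θ (t + 1)) ε (g t) (s t))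
    (hβ : ∀ t ≥ 1, 0 ≤ β t ∧ β t ≤ 1) (hθ : ∀ t ≥ 1, 0 ≤ θ t ∧ θ t ≤ 1) (hg : ∀ t, ‖g t‖ ≤ G)
    (hφ : ∀ t, IsLSmooth L (φ t)) (hφG : ∀ t x, ‖gradient (φ t) x‖ ≤ G) (hC₂ : 0 ≤ C₂)
    (hφ' : ∀ t ≥ 1, ∀ x, ‖gradient (φ (t + 1)) x - gradient (φ t) x‖ ≤ C₂ * η t)
    (hC₁ : 0 ≤ C₁) (hφ₁ : ∀ t ≥ 1, ∀ x, φ (t + 1) x ≤ φ t x + C₁ * η t ^ 2) (hCw : 0 ≤ Cw)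
    (hw : ∀ t ≥ 1, w t = η t + β (t + 1) * w (t + 1) ∧ η t ≤ w t ∧ w t ≤ Cw * η t) (t : ℕ) :
    adamLyapunov φ β w ε s (t + 1) ≤ adamLyapunov φ β w ε s t
      - w (t + 1) * (1 - β (t + 1))
        * inner ℝ (nextGrad φ s t) (diagScale (precond ε (s t).v) (g t))
      + (C₁ + |L| / 2 * (1 / Real.sqrt ε * G) ^ 2 + Cw * (1 / (ε * Real.sqrt ε) * G ^ 4)
          + Cw * (1 / Real.sqrt ε * G * (C₂ + 3 * |L| * (1 / Real.sqrt ε * G))))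
        * (η (t + 1) ^ 2 + η t ^ 2 + η (t + 1) * (1 - θ (t + 1))) := by
  have hG := (norm_nonneg _).trans (hg 0)
  have hη1 := hη (t + 1) (by omega)
  have hθt := hθ (t + 1) (by omega)
  obtain ⟨hw1, hw2, hw3⟩ := hw (t + 1) (by omega)
  have hb := momentumSlope_succ_ge hε hη hm hv hs hβ hθ hg hφ hφG hC₂ hφ' t
  have h1 := hφ₁ (t + 1) (by omega) (s (t + 1)).x
  have h2 := (abs_le.1 ((hφ (t + 1)).abs (s t).x (s (t + 1)).x)).2
  have h3 : |L| / 2 * ‖(s (t + 1)).x - (s t).x‖ ^ 2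
      ≤ |L| / 2 * (η (t + 1) * (1 / Real.sqrt ε * G)) ^ 2 := by
    gcongr
    exact norm_adam_step_le hε hη hm hv hs hβ hθ hg t
  have h4 : inner ℝ (gradient (φ (t + 1)) (s t).x) ((s (t + 1)).x - (s t).x)
      = -(η (t + 1) * momentumSlope φ ε s (t + 1)) := by
    rw [show (s (t + 1)).x - (s t).x = -(η (t + 1) • diagScale (precond ε (s (t + 1)).v)
      (s (t + 1)).m) by rw [hs, adamStep_x]; abel, inner_neg_right, inner_smul_right,
      momentumSlope, Nat.add_sub_cancel, nextGrad]
  have h0 : 0 ≤ 1 - θ (t + 1) := by linarith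
  set a := 1 / (ε * Real.sqrt ε) * G ^ 4 with ha
  set b := 1 / Real.sqrt ε * G * (C₂ + 3 * |L| * (1 / Real.sqrt ε * G)) with hbdef
  have ha0 : 0 ≤ a := by positivity
  have hb0 : 0 ≤ b := by positivity
  have h5 := mul_le_mul_of_nonneg_left hb (hη1.le.trans hw2)
  have h6 : w (t + 1) * (a * (1 - θ (t + 1)) + b * |η t|)
      ≤ Cw * η (t + 1) * (a * (1 - θ (t + 1)) + b * |η t|) := by gcongr
  have h7 : η (t + 1) * |η t| ≤ η (t + 1) ^ 2 + η t ^ 2 := by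
    nlinarith [sq_nonneg (η (t + 1) - |η t|), sq_abs (η t), sq_nonneg (η (t + 1)), sq_nonneg (η t)]
  have h8 : Cw * b * (η (t + 1) * |η t|) ≤ Cw * b * (η (t + 1) ^ 2 + η t ^ 2) := by gcongr
  have h9 : 0 ≤ η (t + 1) * (1 - θ (t + 1)) := by positivity
  -- These surplus terms are added so that every error fits one constant times one common sum.
  have i1 : 0 ≤ C₁ * (η t ^ 2 + η (t + 1) * (1 - θ (t + 1))) := by positivity
  have i2 : 0 ≤ |L| / 2 * (1 / Real.sqrt ε * G) ^ 2
    * (η t ^ 2 + η (t + 1) * (1 - θ (t + 1))) := by positivity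
  have i3 : 0 ≤ Cw * a * (η (t + 1) ^ 2 + η t ^ 2) := by positivity
  have i4 : 0 ≤ Cw * b * (η (t + 1) * (1 - θ (t + 1))) := by positivity
  -- The recursion for w merges the descent term of the new step with the correction term of the new
  -- potential.
  have j1 : w (t + 1) * momentumSlope φ ε s (t + 1) = η (t + 1) * momentumSlope φ ε s (t + 1)
      + β (t + 1 + 1) * w (t + 1 + 1) * momentumSlope φ ε s (t + 1) := by
    conv_lhs => rw [hw1]
    ring
  rw [adamLyapunov, adamLyapunov]
  rw [h4] at h2
  linarith

end Trajectory

/-! ### Independent uniform samples -/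

section Probability

variable {Ω : Type*} [MeasurableSpace Ω] {P : Measure Ω}

lemma ae_summable_of_summable_integral {X : ℕ → Ω → ℝ} (hX : ∀ n, Integrable (X n) P)
    (h0 : ∀ n ω, 0 ≤ X n ω) (hs : Summable fun n => ∫ ω, X n ω ∂P) :
    ∀ᵐ ω ∂P, Summable fun n => X n ω := by
  have h1 : ∫⁻ ω, ∑' n, ENNReal.ofReal (X n ω) ∂P ≠ ⊤ := by
    rw [lintegral_tsum fun n => (hX n).aemeasurable.ennreal_ofReal]
    simp_rw [← ofReal_integral_eq_lintegral_ofReal (hX _) (ae_of_all _ (h0 _))]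
    exact hs.tsum_ofReal_ne_top
  have h2 := ae_lt_top' (AEMeasurable.tsum fun n => (hX n).aemeasurable.ennreal_ofReal) h1
  filter_upwards [h2] with ω hω
  have h3 := ENNReal.summable_toReal hω.ne
  simpa only [ENNReal.toReal_ofReal (h0 _ ω)] using h3

variable [IsProbabilityMeasure P] {K : ℕ} {k : ℕ → Ω → Fin K}

/-- The sequence with prescribed values at the indices `1, …, t`. -/
def extendPast (j : Fin K) (t : ℕ) (p : Finset.range t → Fin K) (n : ℕ) : Fin K :=
  if h : n - 1 ∈ Finset.range t then p ⟨n - 1, h⟩ else j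

lemma extendPast_apply (j : Fin K) (t : ℕ) (κ : ℕ → Fin K) {n : ℕ} (h1 : 1 ≤ n) (h2 : n ≤ t) :
    extendPast j t (fun i => κ (i + 1)) n = κ n := by
  rw [extendPast, dif_pos (Finset.mem_range.2 (by omega))]
  simp only
  congr 1
  omega

/-- Such a quantity factors through the finite set of possible values of the first t samples, so
measurability and boundedness are automatic. -/
lemma integrable_of_dependsOn_past (hk : ∀ t ≥ 1, Measurable (k t)) (t : ℕ)
    {Z : (ℕ → Fin K) → ℝ}
    (hZ : ∀ κ κ' : ℕ → Fin K, (∀ s, 1 ≤ s → s ≤ t → κ s = κ' s) → Z κ = Z κ') :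
    Integrable (fun ω => Z fun s => k s ω) P := by
  obtain ⟨ω₀⟩ := P.nonempty_of_neZero
  have hpast : Measurable fun ω (i : Finset.range t) => k (i + 1) ω :=
    measurable_pi_lambda _ fun i => hk _ (by omega)
  have : IsProbabilityMeasure (P.map fun ω (i : Finset.range t) => k (i + 1) ω) :=
    Measure.isProbabilityMeasure_map hpast.aemeasurable
  have h := (Integrable.of_finite (μ := P.map fun ω (i : Finset.range t) => k (i + 1) ω)
    (f := fun p => Z (extendPast (k 1 ω₀) t p))).comp_measurable hpast
  refine h.congr (ae_of_all _ fun ω => hZ _ _ fun s h1 h2 => ?_)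
  exact extendPast_apply (k 1 ω₀) t (fun s => k s ω) h1 h2

/-- Averaging over a fresh uniform sample. -/
lemma integral_next_sample (hk : ∀ t ≥ 1, Measurable (k t))
    (hk_unif : ∀ t ≥ 1, ∀ j : Fin K, P {ω | k t ω = j} = 1 / (K : ENNReal))
    (hk_indep : iIndepFun (fun t : ℕ => k (t + 1)) P) (t : ℕ) {Z : (ℕ → Fin K) → Fin K → ℝ}
    (hZ : ∀ κ κ' : ℕ → Fin K, (∀ s, 1 ≤ s → s ≤ t → κ s = κ' s) → Z κ = Z κ') :
    ∫ ω, Z (fun s => k s ω) (k (t + 1) ω) ∂P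
      = ∫ ω, (1 / (K : ℝ)) * ∑ j, Z (fun s => k s ω) j ∂P := by
  obtain ⟨ω₀⟩ := P.nonempty_of_neZero
  have hint (j : Fin K) : Integrable (fun ω => Z (fun s => k s ω) j) P :=
    integrable_of_dependsOn_past hk t (Z := fun κ => Z κ j) fun κ κ' h => by rw [hZ κ κ' h]
  have hind : IndepFun (fun ω (i : Finset.range t) => k (i + 1) ω) (k (t + 1)) P := by
    have h := hk_indep.indepFun_finset (Finset.range t) {t} (by simp) fun i => hk _ (by omega)
    exact h.comp measurable_id (measurable_pi_apply (⟨t, by simp⟩ : ({t} : Finset ℕ)))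
  have hprod (j : Fin K) : IndepFun (fun ω => Z (fun s => k s ω) j)
      (fun ω => if k (t + 1) ω = j then (1 : ℝ) else 0) P := by
    have h := hind.comp
      (φ := fun p => Z (extendPast (k 1 ω₀) t p) j) (ψ := fun i => if i = j then (1 : ℝ) else 0)
      (measurable_of_finite _) (measurable_of_finite _)
    have e : (fun ω => Z (fun s => k s ω) j) = (fun p => Z (extendPast (k 1 ω₀) t p) j) ∘
        fun ω (i : Finset.range t) => k (i + 1) ω := by
      ext ω
      rw [Function.comp_apply, hZ _ _ fun s h1 h2 =>
        (extendPast_apply (k 1 ω₀) t (fun s => k s ω) h1 h2).symm]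
    rw [e]
    exact h
  have hset (j : Fin K) : MeasurableSet {ω | k (t + 1) ω = j} :=
    hk (t + 1) (by omega) (measurableSet_singleton j)
  have hone (j : Fin K) : (fun ω => if k (t + 1) ω = j then (1 : ℝ) else 0)
      = {ω | k (t + 1) ω = j}.indicator 1 := by
    ext ω; simp [Set.indicator_apply]
  have hprob (j : Fin K) : ∫ ω, (if k (t + 1) ω = j then (1 : ℝ) else 0) ∂P = 1 / (K : ℝ) := by
    rw [hone, integral_indicator_one (hset j), Measure.real, hk_unif _ (by omega)]
    simp
  have hprodint (j : Fin K) :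
      Integrable (fun ω => Z (fun s => k s ω) j * if k (t + 1) ω = j then (1 : ℝ) else 0) P := by
    refine (hprod j).integrable_mul (hint j) ?_
    rw [hone]
    exact (integrable_const 1).indicator (hset j)
  -- Split by the value j of the new sample: its indicator is independent of the past and has mean
  -- 1/K.
  calc ∫ ω, Z (fun s => k s ω) (k (t + 1) ω) ∂P
      = ∫ ω, ∑ j, Z (fun s => k s ω) j * (if k (t + 1) ω = j then (1 : ℝ) else 0) ∂P := by
        simp
    _ = ∑ j, ∫ ω, Z (fun s => k s ω) j * (if k (t + 1) ω = j then (1 : ℝ) else 0) ∂P :=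
        integral_finsetSum _ fun j _ => hprodint j
    _ = ∑ j, (∫ ω, Z (fun s => k s ω) j ∂P) * (1 / (K : ℝ)) := by
        refine Finset.sum_congr rfl fun j _ => ?_
        rw [(hprod j).integral_fun_mul_eq_mul_integral (hint j).aestronglyMeasurable
          ?_, hprob]
        rw [hone]
        exact ((integrable_const 1).indicator (hset j)).aestronglyMeasurable
    _ = _ := by
        rw [integral_const_mul, integral_finsetSum _ fun j _ => hint j, ← Finset.sum_mul, mul_comm]

end Probability

/-! ### Unbiasedness of the sampled gradients -/

section Sampling

variable {d K : ℕ} {F : Fin K → EuclideanSpace ℝ (Fin d) → ℝ} {f : EuclideanSpace ℝ (Fin d) → ℝ}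
  {G : ℝ}

lemma gsmoothAdam_congr (η β θ σ : ℕ → ℝ) (ε : ℝ) (x₀ : EuclideanSpace ℝ (Fin d))
    {κ κ' : ℕ → Fin K} (t : ℕ) (h : ∀ s, 1 ≤ s → s ≤ t → κ s = κ' s) :
    gsmoothAdam F η β θ σ ε x₀ κ t = gsmoothAdam F η β θ σ ε x₀ κ' t := by
  induction t with
  | zero => rfl
  | succ t ih =>
    rw [gsmoothAdam, gsmoothAdam, ih fun s h1 h2 => h s h1 (by omega), h (t + 1) (by omega) le_rfl]

lemma abs_mean_sub_le (hK : 0 < K) (hf : ∀ x, (1 / (K : ℝ)) * ∑ j, F j x = f x)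
    (hG : ∀ j x y, ‖F j x - F j y‖ ≤ G * ‖x - y‖) (x y : EuclideanSpace ℝ (Fin d)) :
    ‖f x - f y‖ ≤ G * ‖x - y‖ := by
  have hK' : (0 : ℝ) < K := by exact_mod_cast hK
  rw [← hf, ← hf, ← mul_sub, ← Finset.sum_sub_distrib, norm_mul,
    Real.norm_of_nonneg (by positivity), one_div, inv_mul_le_iff₀ hK']
  refine (norm_sum_le_of_le _ fun j _ => hG j x y).trans (by simp)

/-- Smoothing is linear, so the identity of means for functions passes to the smoothings and can
then be differentiated. -/
lemma mean_gradient_gaussianSmooth (hf : ∀ x, (1 / (K : ℝ)) * ∑ j, F j x = f x)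
    (hF : ∀ j, Differentiable ℝ (F j)) (hG : ∀ j x y, ‖F j x - F j y‖ ≤ G * ‖x - y‖) (τ : ℝ)
    (x : EuclideanSpace ℝ (Fin d)) :
    (1 / (K : ℝ)) • ∑ j, gradient (gaussianSmooth τ (F j)) x = gradient (gaussianSmooth τ f) x := by
  have hd (j : Fin K) := differentiable_gaussianSmooth (hF j) (hG j) τ
  have e : gaussianSmooth τ f = fun x => (1 / (K : ℝ)) * ∑ j, gaussianSmooth τ (F j) x := by
    ext y
    simp_rw [gaussianSmooth_eq_integral, ← hf]
    rw [integral_const_mul,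
      integral_finsetSum _ fun j _ => integrable_comp_add_smul (hG j) τ y]
  have h : HasFDerivAt (gaussianSmooth τ f)
      ((1 / (K : ℝ)) • ∑ j, fderiv ℝ (gaussianSmooth τ (F j)) x) x := by
    rw [e]
    exact (HasFDerivAt.fun_sum fun j _ => (hd j x).hasFDerivAt).const_mul _
  rw [gradient, h.fderiv]
  simp only [gradient, map_sum, map_smulₛₗ, conj_trivial]

end Sampling

/-! ### Consequences of the hypotheses -/

lemma abs_sub_le_sqrt_abs_sq_sub {a b : ℝ} (ha : 0 ≤ a) (hb : 0 ≤ b) :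
    |a - b| ≤ Real.sqrt |b ^ 2 - a ^ 2| := by
  refine Real.abs_le_sqrt ?_
  rw [show b ^ 2 - a ^ 2 = -((a - b) * (a + b)) by ring, abs_neg, abs_mul,
    abs_of_nonneg (add_nonneg ha hb), ← sq_abs, sq]
  gcongr
  exact abs_le.2 ⟨by linarith, by linarith⟩

end

/-- A single squared gradient is at most the sum of all K of them, hence at most K times the mean
bound. -/
lemma norm_sub_le_of_mean_sq_gradient_le {d K : ℕ} {F : Fin K → EuclideanSpace ℝ (Fin d) → ℝ}
    {lam : ℝ} (hK : 0 < K) (hF : ∀ j, Differentiable ℝ (F j))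
    (hvar : ∀ x, (1 / (K : ℝ)) * ∑ j, ‖gradient (F j) x‖ ^ 2 ≤ lam) (j : Fin K)
    (x y : EuclideanSpace ℝ (Fin d)) : ‖F j x - F j y‖ ≤ Real.sqrt (K * lam) * ‖x - y‖ := by
  refine norm_sub_le_of_norm_gradient_le (hF j) (fun z => Real.le_sqrt_of_sq_le ?_) x y
  have hK' : (0 : ℝ) < K := by exact_mod_cast hK
  have h1 := hvar z
  rw [one_div, inv_mul_le_iff₀ hK'] at h1
  exact (Finset.single_le_sum (f := fun j => ‖gradient (F j) z‖ ^ 2)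
    (fun i _ => sq_nonneg _) (Finset.mem_univ j)).trans h1

lemma IsLSmooth.differentiable {d : ℕ} {L : ℝ} {f : EuclideanSpace ℝ (Fin d) → ℝ}
    (h : IsLSmooth L f) : Differentiable ℝ f := fun x =>
  (hasGradientAt_of_abs_sub_le (h x)).differentiableAt

/-- Both sides are continuous, and Lebesgue measure charges every nonempty open set. -/
lemma mean_eq_of_ae_eq {d K : ℕ} {F : Fin K → EuclideanSpace ℝ (Fin d) → ℝ}
    {f : EuclideanSpace ℝ (Fin d) → ℝ} (hF : ∀ j, Continuous (F j)) (hf : Continuous f)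
    (h : ∀ᵐ x : EuclideanSpace ℝ (Fin d), (1 / (K : ℝ)) * ∑ j, F j x = f x)
    (x : EuclideanSpace ℝ (Fin d)) : (1 / (K : ℝ)) * ∑ j, F j x = f x := by
  have hc : Continuous fun x => (1 / (K : ℝ)) * ∑ j, F j x := by fun_prop
  exact congrFun ((hc.ae_eq_iff_eq volume hf).1 h) x

lemma not_summable_succ_of_tendsto_sum_Icc {η : ℕ → ℝ}
    (h : Tendsto (fun T : ℕ => ∑ t ∈ Finset.Icc 1 T, η t) atTop atTop) :
    ¬ Summable fun t => η (t + 1) := by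
  intro hs
  refine not_tendsto_nhds_of_tendsto_atTop h (∑' t, η (t + 1)) ?_
  · have e : (fun T : ℕ => ∑ t ∈ Finset.Icc 1 T, η t)
        = fun T => ∑ t ∈ Finset.range T, η (t + 1) := by
      ext T
      induction T with
      | zero => simp
      | succ T ih => rw [Finset.sum_Icc_succ_top (by omega), Finset.sum_range_succ, ih]
    rw [e]
    exact hs.hasSum.tendsto_sum_nat

lemma tendsto_zero_of_summable_sq {η : ℕ → ℝ} (h : Summable fun t => η t ^ 2) :
    Tendsto η atTop (𝓝 0) := by
  have := h.tendsto_atTop_zero.sqrt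
  simp only [Real.sqrt_sq_eq_abs, Real.sqrt_zero] at this
  exact (tendsto_zero_iff_abs_tendsto_zero _).2 this

/-! ### The convergence theorem -/

set_option maxHeartbeats 1600000 in
theorem theorem3 {d K : ℕ}
    -- the sample functions and the objective
    (F : Fin K → EuclideanSpace ℝ (Fin d) → ℝ) (f : EuclideanSpace ℝ (Fin d) → ℝ)
    (L lam : ℝ)
    (hF : ∀ j, Differentiable ℝ (F j))
    (hsmooth : IsLSmooth L f)
    (hbdd : BddBelow (Set.range f))
    (hunbiased : ∀ᵐ x : EuclideanSpace ℝ (Fin d), (1 / (K : ℝ)) * ∑ j, F j x = f x)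
    (hunbiased_grad : ∀ᵐ x : EuclideanSpace ℝ (Fin d),
      (1 / (K : ℝ)) • ∑ j, gradient (F j) x = gradient f x)
    (hvar : ∀ x, (1 / (K : ℝ)) * ∑ j, ‖gradient (F j) x‖ ^ 2 ≤ lam)
    -- the parameters of the algorithm
    (η β θ σ : ℕ → ℝ) (ε βmax : ℝ) (x₀ : EuclideanSpace ℝ (Fin d))
    (hη : ∀ t ≥ 1, 0 < η t) (hε : 0 < ε)
    (hβ : ∀ t ≥ 1, 0 ≤ β t ∧ β t ≤ βmax) (hβmax : βmax < 1)
    (hθ : ∀ t ≥ 1, 0 < θ t ∧ θ t < 1)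
    (hσ : ∀ t ≥ 1, 0 ≤ σ t)
    -- independent uniform samples `k t`, for `t ≥ 1`
    {Ω : Type*} [MeasurableSpace Ω] (P : Measure Ω) [IsProbabilityMeasure P]
    (k : ℕ → Ω → Fin K)
    (hk_meas : ∀ t ≥ 1, Measurable (k t))
    (hk_unif : ∀ t ≥ 1, ∀ j : Fin K, P {ω | k t ω = j} = 1 / (K : ENNReal))
    (hk_indep : iIndepFun (fun t : ℕ => k (t + 1)) P)
    -- conditions on the step sizes
    (hη_sum : Tendsto (fun T : ℕ => ∑ t ∈ Finset.Icc 1 T, η t) atTop atTop)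
    (hη_sq : Summable (fun t : ℕ => η (t + 1) ^ 2))
    (hηθ : Summable (fun t : ℕ => η (t + 1) * (1 - θ (t + 1))))
    (hα : ∃ α : ℕ → ℝ, AntitoneOn α (Set.Ici 1) ∧
      ∃ C₀ > 0, ∃ C₁ > 0, ∀ t ≥ 1, C₀ * α t ≤ η t ∧ η t ≤ C₁ * α t)
    -- conditions on the smoothing parameters
    (hσ_diff : ∀ t ≥ 1, Real.sqrt |σ t ^ 2 - σ (t + 1) ^ 2| ≤ η t)
    (hσ_lim : Tendsto σ atTop (𝓝 0)) :
    (∀ᵐ ω ∂P, Tendsto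
      (fun t : ℕ => ‖gradient f (gsmoothAdam F η β θ σ ε x₀ (fun s => k s ω) t).x‖ ^ 2)
      atTop (𝓝 0)) ∧
    (∀ t : ℕ, Integrable
      (fun ω => ‖gradient f (gsmoothAdam F η β θ σ ε x₀ (fun s => k s ω) t).x‖ ^ 2) P) ∧
    Tendsto
      (fun t : ℕ =>
        ∫ ω, ‖gradient f (gsmoothAdam F η β θ σ ε x₀ (fun s => k s ω) t).x‖ ^ 2 ∂P)
      atTop (𝓝 0) := by
  have hK : 0 < K := by
    obtain ⟨ω₀⟩ := P.nonempty_of_neZero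
    exact (k 1 ω₀).pos
  -- uniform Lipschitz bounds
  set G := Real.sqrt (K * lam) with hGdef
  have hG0 : 0 ≤ G := Real.sqrt_nonneg _
  have hFG := norm_sub_le_of_mean_sq_gradient_le hK hF hvar
  have hmean := mean_eq_of_ae_eq (fun j => (hF j).continuous) hsmooth.differentiable.continuous
    hunbiased
  have hfG := abs_mean_sub_le hK hmean hFG
  have hsmoothG {g : EuclideanSpace ℝ (Fin d) → ℝ} (hg : ∀ x y, ‖g x - g y‖ ≤ G * ‖x - y‖)
      (τ : ℝ) (x : EuclideanSpace ℝ (Fin d)) : ‖gradient (gaussianSmooth τ g) x‖ ≤ G :=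
    norm_gradient_le_of_norm_sub_le hG0 (fun y z => by
      simpa only [gaussianSmooth_eq_integral] using norm_integral_comp_sub_le hg τ y z) x
  -- the smoothed objectives
  set φ : ℕ → EuclideanSpace ℝ (Fin d) → ℝ := fun t => gaussianSmooth (σ t) f with hφdef
  have hφ (t : ℕ) : IsLSmooth |L| (φ t) := hsmooth.gaussianSmooth hfG (σ t)
  have hφG (t : ℕ) (x) : ‖gradient (φ t) x‖ ≤ G := hsmoothG hfG (σ t) x
  set C₁ := 7 * |L| * ∫ u, ‖u‖ ^ 2 ∂gaussMeasure d with hC₁def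
  set C₂ := 3 * |L| * ∫ u, ‖u‖ ∂gaussMeasure d with hC₂def
  have hC₁ : 0 ≤ C₁ := mul_nonneg (by positivity) (integral_nonneg fun u => by positivity)
  have hC₂ : 0 ≤ C₂ := mul_nonneg (by positivity) (integral_nonneg fun u => by positivity)
  have hφ' : ∀ t ≥ 1, ∀ x, ‖gradient (φ (t + 1)) x - gradient (φ t) x‖ ≤ C₂ * η t := by
    intro t ht x
    refine (hsmooth.norm_gradient_gaussianSmooth_sub_le hfG (σ (t + 1)) (σ t) x).trans ?_
    exact mul_le_mul_of_nonneg_left ((abs_sub_le_sqrt_abs_sq_sub (hσ _ (by omega))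
      (hσ t ht)).trans (hσ_diff t ht)) hC₂
  have hφ₁ : ∀ t ≥ 1, ∀ x, φ (t + 1) x ≤ φ t x + C₁ * η t ^ 2 := by
    intro t ht x
    have h1 := (abs_le.1 (hsmooth.abs_gaussianSmooth_sub_le_sq_sub hfG (σ (t + 1)) (σ t)
      (hσ _ (by omega)) (hσ t ht) x)).2
    have h2 : |σ (t + 1) ^ 2 - σ t ^ 2| ≤ η t ^ 2 := by
      rw [abs_sub_comm, ← Real.sqrt_le_left (hη t ht).le]
      exact hσ_diff t ht
    have h3 := mul_le_mul_of_nonneg_left h2 hC₁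
    linarith
  -- the parameters
  have hβ1 : ∀ t ≥ 1, 0 ≤ β t ∧ β t ≤ 1 := fun t ht =>
    ⟨(hβ t ht).1, (hβ t ht).2.trans hβmax.le⟩
  have hθ1 : ∀ t ≥ 1, 0 ≤ θ t ∧ θ t ≤ 1 := fun t ht => ⟨(hθ t ht).1.le, (hθ t ht).2.le⟩
  obtain ⟨w, Cw, hCw, hw⟩ : ∃ w : ℕ → ℝ, ∃ C : ℝ, 0 ≤ C ∧ ∀ t ≥ 1,
      w t = η t + β (t + 1) * w (t + 1) ∧ η t ≤ w t ∧ w t ≤ C * η t := by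
    obtain ⟨α, hα, C₀, hC₀, C', hC', h⟩ := hα
    -- Comparability with a non-increasing α bounds all later step sizes by C'/C₀ times the current
    -- one.
    refine exists_momentum_weights (R := C' / C₀) hη hβ hβmax fun t ht n => ?_
    have h1 : α (t + n) ≤ α t := hα (Set.mem_Ici.2 ht) (Set.mem_Ici.2 (by omega)) (by omega)
    calc η (t + n) ≤ C' * α (t + n) := (h _ (by omega)).2
      _ ≤ C' * α t := by gcongr
      _ = C' / C₀ * (C₀ * α t) := by field_simp
      _ ≤ C' / C₀ * η t := by gcongr; exact (h t ht).1
  -- the trajectories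
  set S : (ℕ → Fin K) → ℕ → AdamState d := fun κ => gsmoothAdam F η β θ σ ε x₀ κ with hS
  set γ : (ℕ → Fin K) → ℕ → EuclideanSpace ℝ (Fin d) := fun κ t =>
    gradient (gaussianSmooth (σ (t + 1)) (F (κ (t + 1)))) (S κ t).x with hγ
  have hS0m (κ) : (S κ 0).m = 0 := rfl
  have hS0v (κ) : (S κ 0).v = 0 := rfl
  have hSsucc (κ) (t) : S κ (t + 1)
      = adamStep (η (t + 1)) (β (t + 1)) (θ (t + 1)) ε (γ κ t) (S κ t) := rfl
  have hγG (κ) (t) : ‖γ κ t‖ ≤ G := hsmoothG (hFG _) _ _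
  have hScongr (t) (κ κ' : ℕ → Fin K) (h : ∀ s, 1 ≤ s → s ≤ t → κ s = κ' s) :
      S κ t = S κ' t := gsmoothAdam_congr η β θ σ ε x₀ t h
  have hbound (κ) := adam_bounded (hS0m κ) (hS0v κ) (hSsucc κ) hβ1 hθ1 (hγG κ)
  set V : (ℕ → Fin K) → ℕ → ℝ := fun κ t => adamLyapunov φ β w ε (S κ) t with hV
  set Z : ℕ → (ℕ → Fin K) → Fin K → ℝ := fun t κ j =>
    inner ℝ (nextGrad φ (S κ) t) (diagScale (precond ε (S κ t).v)
      (gradient (gaussianSmooth (σ (t + 1)) (F j)) (S κ t).x)) with hZ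
  set Q : (ℕ → Fin K) → ℕ → ℝ := fun κ t =>
    inner ℝ (nextGrad φ (S κ) t) (diagScale (precond ε (S κ t).v) (nextGrad φ (S κ) t)) with hQ
  have hpcongr (t) (κ κ' : ℕ → Fin K) (h : ∀ s, 1 ≤ s → s ≤ t → κ s = κ' s) :
      nextGrad φ (S κ) t = nextGrad φ (S κ') t := by
    rw [nextGrad, nextGrad, hScongr t κ κ' h]
  have hZcongr (t) (κ κ' : ℕ → Fin K) (h : ∀ s, 1 ≤ s → s ≤ t → κ s = κ' s) :
      Z t κ = Z t κ' := by
    simp only [hZ, hpcongr t κ κ' h, hScongr t κ κ' h]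
  have hQcongr (t) (κ κ' : ℕ → Fin K) (h : ∀ s, 1 ≤ s → s ≤ t → κ s = κ' s) :
      Q κ t = Q κ' t := by
    simp only [hQ, hpcongr t κ κ' h, hScongr t κ κ' h]
  have hVcongr (t) (κ κ' : ℕ → Fin K) (h : ∀ s, 1 ≤ s → s ≤ t → κ s = κ' s) :
      V κ t = V κ' t := by
    simp only [hV, adamLyapunov, momentumSlope, hScongr t κ κ' h,
      hpcongr (t - 1) κ κ' fun s h1 h2 => h s h1 (by omega)]
  have hZmean (t) (κ) : (1 / (K : ℝ)) * ∑ j, Z t κ j = Q κ t := by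
    simp only [hZ, hQ]
    rw [← inner_sum, ← map_sum, ← inner_smul_right, ← map_smul,
      mean_gradient_gaussianSmooth hmean hF hFG]
    rfl
  have hVint (t : ℕ) : Integrable (fun ω => V (fun s => k s ω) t) P :=
    integrable_of_dependsOn_past hk_meas t (Z := fun κ => V κ t) (hVcongr t)
  have hQint (t : ℕ) : Integrable (fun ω => Q (fun s => k s ω) t) P :=
    integrable_of_dependsOn_past hk_meas t (Z := fun κ => Q κ t) (hQcongr t)
  have hZint (t : ℕ) : Integrable (fun ω => Z t (fun s => k s ω) (k (t + 1) ω)) P :=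
    integrable_of_dependsOn_past hk_meas (t + 1) (Z := fun κ => Z t κ (κ (t + 1)))
      fun κ κ' h => by
        rw [hZcongr t κ κ' fun s h1 h2 => h s h1 (by omega), h (t + 1) (by omega) le_rfl]
  -- expected decrease of the Lyapunov function
  set Ce := C₁ + |(|L|)| / 2 * (1 / Real.sqrt ε * G) ^ 2 + Cw * (1 / (ε * Real.sqrt ε) * G ^ 4)
    + Cw * (1 / Real.sqrt ε * G * (C₂ + 3 * |(|L|)| * (1 / Real.sqrt ε * G))) with hCe
  have hCe0 : 0 ≤ Ce := by positivity
  set e : ℕ → ℝ := fun t => Ce * (η (t + 1) ^ 2 + η t ^ 2 + η (t + 1) * (1 - θ (t + 1))) with he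
  -- The term with `η 0`, an unconstrained value, is a single summand and does not affect
  -- summability.
  have hesum : Summable e :=
    ((hη_sq.add ((summable_nat_add_iff 1).1 hη_sq)).add hηθ).mul_left Ce
  have he0 (t) : 0 ≤ e t := by
    have h1 := (hη (t + 1) (by omega)).le
    have h2 : 0 ≤ 1 - θ (t + 1) := by linarith [(hθ (t + 1) (by omega)).2]
    exact mul_nonneg hCe0 (by positivity)
  have hVstep (κ) (t) : V κ (t + 1) ≤ V κ t - w (t + 1) * (1 - β (t + 1)) * Z t κ (κ (t + 1))
      + e t :=
    adamLyapunov_succ_le hε hη (hS0m κ) (hS0v κ) (hSsucc κ) hβ1 hθ1 (hγG κ) hφ hφG hC₂ hφ' hC₁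
      hφ₁ hCw hw t
  have hEstep (t) : ∫ ω, V (fun s => k s ω) (t + 1) ∂P ≤ ∫ ω, V (fun s => k s ω) t ∂P
      - w (t + 1) * (1 - β (t + 1)) * ∫ ω, Q (fun s => k s ω) t ∂P + e t := by
    have h1 : ∫ ω, Z t (fun s => k s ω) (k (t + 1) ω) ∂P = ∫ ω, Q (fun s => k s ω) t ∂P := by
      rw [integral_next_sample hk_meas hk_unif hk_indep t (hZcongr t)]
      simp only [hZmean]
    rw [← h1, ← integral_const_mul, ← integral_sub (hVint t) ((hZint t).const_mul _)]
    calc ∫ ω, V (fun s => k s ω) (t + 1) ∂P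
        ≤ ∫ ω, (V (fun s => k s ω) t - w (t + 1) * (1 - β (t + 1))
            * Z t (fun s => k s ω) (k (t + 1) ω) + e t) ∂P :=
          integral_mono (hVint (t + 1))
            (((hVint t).sub ((hZint t).const_mul _)).add (integrable_const _))
            fun ω => hVstep (fun s => k s ω) t
      _ = _ := by
          rw [integral_add ((hVint t).sub' ((hZint t).const_mul _)) (integrable_const _)]
          simp
  -- the Lyapunov function is bounded below
  obtain ⟨b, hb⟩ := hbdd
  have hb' (x) : b ≤ f x := hb ⟨x, rfl⟩
  obtain ⟨Cη, hCη⟩ : ∃ Cη, ∀ t, η (t + 1) ≤ Cη := by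
    obtain ⟨c, hc⟩ := (tendsto_zero_of_summable_sq hη_sq).bddAbove_range
    exact ⟨c, fun t => hc ⟨t, rfl⟩⟩
  set Vmin := b - Cw * Cη * (1 / Real.sqrt ε * G * G) with hVmin
  have hVbelow (κ) (t) : Vmin ≤ V κ t := by
    have h1 := le_gaussianSmooth hfG hb' (σ (t + 1)) (S κ t).x
    have h2 := abs_momentumSlope_le hε (hS0m κ) (hS0v κ) (hSsucc κ) hβ1 hθ1 (hγG κ) hφG t
    obtain ⟨-, h3, h4⟩ := hw (t + 1) (by omega)
    have h5 : 0 ≤ w (t + 1) := (hη (t + 1) (by omega)).le.trans h3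
    have h6 : β (t + 1) * w (t + 1) ≤ Cw * Cη :=
      (mul_le_of_le_one_left h5 (hβ1 (t + 1) (by omega)).2).trans
        (h4.trans (mul_le_mul_of_nonneg_left (hCη t) hCw))
    have h7 : |β (t + 1) * w (t + 1) * momentumSlope φ ε (S κ) t|
        ≤ Cw * Cη * (1 / Real.sqrt ε * G * G) := by
      rw [abs_mul, abs_of_nonneg (mul_nonneg (hβ1 (t + 1) (by omega)).1 h5)]
      have h8 : 0 ≤ β (t + 1) * w (t + 1) := mul_nonneg (hβ1 (t + 1) (by omega)).1 h5
      exact mul_le_mul h6 h2 (abs_nonneg _) (h8.trans h6)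
    have h8 := (abs_le.1 h7).2
    simp only [hV, adamLyapunov, hVmin]
    linarith
  have hEbelow (t) : Vmin ≤ ∫ ω, V (fun s => k s ω) t ∂P := by
    calc Vmin = ∫ _, Vmin ∂P := by simp
      _ ≤ _ := integral_mono (integrable_const _) (hVint t) fun ω => hVbelow _ t
  -- almost sure summability of the squared gradients
  set c := 1 / Real.sqrt (G ^ 2 + ε) with hc
  have hc0 : 0 < c := by positivity
  -- The bound v ≤ G² keeps every diagonal entry of the preconditioner above c.
  have hQge (κ) (t) : c * ‖nextGrad φ (S κ) t‖ ^ 2 ≤ Q κ t := by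
    refine le_inner_diagScale_self (fun i => ?_) _
    have h1 := (hbound κ t).2 i
    rw [hc, precond]
    exact one_div_le_one_div_of_le (Real.sqrt_pos.2 (by linarith [h1.1]))
      (Real.sqrt_le_sqrt (by linarith [h1.2]))
  have hQ0 (κ) (t) : 0 ≤ Q κ t := (by positivity : (0 : ℝ) ≤ _).trans (hQge κ t)
  have hEQ0 (t) : 0 ≤ ∫ ω, Q (fun s => k s ω) t ∂P := integral_nonneg fun ω => hQ0 _ t
  have hwβ (t) : (1 - βmax) * η (t + 1) ≤ w (t + 1) * (1 - β (t + 1)) := by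
    have h1 := hη (t + 1) (by omega)
    obtain ⟨-, h3, -⟩ := hw (t + 1) (by omega)
    have h4 := (hβ (t + 1) (by omega)).2
    rw [mul_comm]
    exact mul_le_mul h3 (by linarith) (by linarith) (h1.le.trans h3)
  have hsumEQ : Summable fun t => w (t + 1) * (1 - β (t + 1)) * ∫ ω, Q (fun s => k s ω) t ∂P := by
    refine summable_of_sum_range_le (c := ∫ ω, V (fun s => k s ω) 0 ∂P - Vmin + ∑' t, e t)
      (fun t => mul_nonneg ((mul_nonneg (by linarith) (hη (t + 1) (by omega)).le).trans (hwβ t))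
        (hEQ0 t)) fun T => ?_
    have h1 : ∑ t ∈ Finset.range T, w (t + 1) * (1 - β (t + 1)) * ∫ ω, Q (fun s => k s ω) t ∂P
        ≤ ∫ ω, V (fun s => k s ω) 0 ∂P - ∫ ω, V (fun s => k s ω) T ∂P
          + ∑ t ∈ Finset.range T, e t := by
      induction T with
      | zero => simp
      | succ T ih =>
        rw [Finset.sum_range_succ, Finset.sum_range_succ]
        linarith [hEstep T]
    linarith [hEbelow T, hesum.sum_le_tsum (Finset.range T) fun t _ => he0 t]
  have hpint (t : ℕ) :
      Integrable (fun ω => η (t + 1) * ‖nextGrad φ (S fun s => k s ω) t‖ ^ 2) P :=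
    integrable_of_dependsOn_past hk_meas t
      (Z := fun κ => η (t + 1) * ‖nextGrad φ (S κ) t‖ ^ 2) fun κ κ' h => by
        rw [hpcongr t κ κ' h]
  have hae : ∀ᵐ ω ∂P, Summable fun t => η (t + 1) * ‖nextGrad φ (S fun s => k s ω) t‖ ^ 2 := by
    refine ae_summable_of_summable_integral hpint
      (fun t ω => mul_nonneg (hη (t + 1) (by omega)).le (sq_nonneg _)) ?_
    refine (hsumEQ.mul_left ((1 - βmax)⁻¹ * c⁻¹)).of_nonneg_of_le
      (fun t => integral_nonneg fun ω => mul_nonneg (hη (t + 1) (by omega)).le (sq_nonneg _))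
      fun t => ?_
    have hβ' : 0 < 1 - βmax := by linarith
    have h1 : ∫ ω, η (t + 1) * ‖nextGrad φ (S fun s => k s ω) t‖ ^ 2 ∂P
        ≤ ∫ ω, η (t + 1) * c⁻¹ * Q (fun s => k s ω) t ∂P := by
      refine integral_mono (hpint t) ((hQint t).const_mul _) fun ω => ?_
      change _ ≤ η (t + 1) * c⁻¹ * Q (fun s => k s ω) t
      rw [mul_assoc]
      refine mul_le_mul_of_nonneg_left ?_ (hη (t + 1) (by omega)).le
      rw [← div_eq_inv_mul, le_div_iff₀ hc0, mul_comm]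
      exact hQge _ t
    rw [integral_const_mul (η (t + 1) * c⁻¹)] at h1
    refine h1.trans ?_
    have h2 : η (t + 1) ≤ (1 - βmax)⁻¹ * (w (t + 1) * (1 - β (t + 1))) := by
      rw [← div_eq_inv_mul, le_div_iff₀ hβ', mul_comm]
      exact hwβ t
    calc η (t + 1) * c⁻¹ * ∫ ω, Q (fun s => k s ω) t ∂P
        ≤ (1 - βmax)⁻¹ * (w (t + 1) * (1 - β (t + 1))) * c⁻¹ * ∫ ω, Q (fun s => k s ω) t ∂P := by
          have := hEQ0 t
          gcongr
      _ = _ := by ring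
  -- convergence of the gradients along almost every trajectory
  have hmain : ∀ᵐ ω ∂P, Tendsto (fun t : ℕ => ‖gradient f (S (fun s => k s ω) t).x‖ ^ 2)
      atTop (𝓝 0) := by
    filter_upwards [hae] with ω hω
    set κ : ℕ → Fin K := fun s => k s ω with hκ
    have h1 : Tendsto (fun t => ‖nextGrad φ (S κ) t‖ ^ 2) atTop (𝓝 0) := by
      refine tendsto_zero_of_summable_mul (η := fun t => η (t + 1))
        (C := 2 * G * (C₂ + 3 * |(|L|)| * (1 / Real.sqrt ε * G)))
        (fun t => (hη (t + 1) (by omega)).le) (fun t => sq_nonneg _)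
        (tendsto_zero_of_summable_sq hη_sq) (not_summable_succ_of_tendsto_sum_Icc hη_sum) hω
        fun t => ?_
      have h2 := norm_nextGrad_sub_le hε hη (hS0m κ) (hS0v κ) (hSsucc κ) hβ1 hθ1 (hγG κ) hφ hφ' t
      have h3 := (abs_norm_sub_norm_le (nextGrad φ (S κ) (t + 1)) (nextGrad φ (S κ) t)).trans h2
      have h4 : ‖nextGrad φ (S κ) (t + 1)‖ ≤ G := hφG _ _
      have h5 : ‖nextGrad φ (S κ) t‖ ≤ G := hφG _ _
      rw [sq_sub_sq, abs_mul, abs_of_nonneg (by positivity), mul_assoc]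
      exact mul_le_mul (by linarith) h3 (abs_nonneg _) (by positivity)
    have h2 : Tendsto (fun t => ‖nextGrad φ (S κ) t‖) atTop (𝓝 0) := by
      simpa [Real.sqrt_sq_eq_abs] using h1.sqrt
    have h3 : Tendsto (fun t => ‖nextGrad φ (S κ) t‖ + C₂ * |σ (t + 1)|) atTop (𝓝 0) := by
      simpa using h2.add ((((tendsto_add_atTop_iff_nat 1).2 hσ_lim).abs).const_mul C₂)
    have h4 : Tendsto (fun t => ‖gradient f (S κ t).x‖) atTop (𝓝 0) := by
      refine squeeze_zero (fun t => norm_nonneg _) (fun t => ?_) h3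
      -- Smoothing at scale 0 is f itself, so this compares ∇f with the gradient of the smoothed
      -- objective.
      have h5 := hsmooth.norm_gradient_gaussianSmooth_sub_le hfG 0 (σ (t + 1)) (S κ t).x
      rw [hsmooth.gradient_gaussianSmooth hfG 0] at h5
      simp only [zero_smul, add_zero, integral_const, probReal_univ, one_smul, zero_sub,
        abs_neg] at h5
      have h6 := norm_le_norm_add_norm_sub' (gradient f (S κ t).x) (nextGrad φ (S κ) t)
      exact h6.trans (by gcongr; exact h5)
    simpa using h4.pow 2
  have hint (t : ℕ) : Integrable (fun ω => ‖gradient f (S (fun s => k s ω) t).x‖ ^ 2) P :=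
    integrable_of_dependsOn_past hk_meas t (Z := fun κ => ‖gradient f (S κ t).x‖ ^ 2)
      fun κ κ' h => by rw [hScongr t κ κ' h]
  refine ⟨hmain, hint, ?_⟩
  have hdom := tendsto_integral_of_dominated_convergence (μ := P) (fun _ => G ^ 2)
    (fun t => (hint t).aestronglyMeasurable) (integrable_const _)
    (fun t => ae_of_all _ fun ω => ?_) hmain
  · simpa using hdom
  · rw [Real.norm_of_nonneg (sq_nonneg _)]
    gcongr
    exact norm_gradient_le_of_norm_sub_le hG0 hfG _
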